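/- **Setting.** Let $\mathcal A$ be a finite alphabet, $\mathcal N\subset\mathbb Z$ a finite set, and $F:\mathcal A^{\mathbb Z}\to\mathcal A^{\mathbb Z}$, $(Fx)_i=f(x_{i+\mathcal N})$, the cellular automaton with local rule $f:\mathcal A^{\mathcal N}\to\mathcal A$. A *perturbation* $(F_\epsilon)_{\epsilon>0}$ of $F$ is a family of probabilistic cellular automata with the same alphabet and neighbourhood, given by stochastic matrices $f_\epsilon:\mathcal A^{\mathcal N}\times\mathcal A\to[0,1]$ such that $f_\epsilon(u,f(u))\ge 1-\epsilon$ for all $\epsilon>0$ and $u\in\mathcal A^{\mathcal N}$: from a configuration $x$, the symbols at all sites $i\in\mathbb Z$ are updated independently, with laws $f_\epsilon(x_{i+\mathcal N},\cdot)$. Put $f_0(u,a)=1$ if $f(u)=a$ and $f_0(u,a)=0$ otherwise. Let $\mathcal M$ be the set of shift-invariant Borel probability measures on $\mathcal A^{\mathbb Z}$, with the distance $$d(\mu,\nu)=\sum_{n\ge 0}2^{-n}\,\tfrac12\sum_{u\in\mathcal A^{\{-n,\dots,n\}}}|\mu([u])-\nu([u])| ,$$ where $[u]$ is the cylinder of configurations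 that agree with $u$ on $\{-n,\dots,n\}$. For a non-empty word $w$ over $\mathcal A$, let $\widehat{\delta_w}\in\mathcal M$ be the shift-invariant probability measure supported by the orbit of the periodic configuration $\dots www\dots$. Let $\mathcal M_\epsilon\subset\mathcal M$ be the set of $F_\epsilon$-invariant measures in $\mathcal M$. For a family $(M_\epsilon)_{\epsilon>0}$ of subsets of $\mathcal M$, let $\mathrm{Acc}_{\epsilon\to0}M_\epsilon$ be the set of $\mu\in\mathcal M$ such that for all $\delta>0$ and $\epsilon_0>0$ there are $\epsilon\in(0,\epsilon_0)$ and $\nu\in M_\epsilon$ with $d(\mu,\nu)<\delta$. Put $\mathcal M_{\lim}=\mathrm{Acc}_{\epsilon\to0}\mathcal M_\epsilon$. - $\mathcal M_{\lim}$ is *uniformly approached* if $\mathcal M_{\lim}=\mathrm{Acc}_{\epsilon\to0}\{\pi_\epsilon\}$ for every family $(\pi_\epsilon)_{\epsilon>0}$ with $\pi_\epsilon\in\mathcal M_\epsilon$ for all $\epsilon>0$. - The perturbation is *computable* if $\epsilon\mapsto f_\epsilon\in[0,1]^{\mathcal A^{\mathcal N}\times\mathcal A}$ is computable on $[0,1]$,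 that is, for each entry $g(\epsilon)=f_\epsilon(u,a)$ there are computable functions $\alpha:\mathbb N\to\mathbb N$ and $\beta:(\mathbb Q\cap[0,1])\times\mathbb N\to\mathbb Q\cap[0,1]$ such that $|s-t|\le2^{-\alpha(n)}$ implies $|g(s)-g(t)|\le2^{-n}$ for all $s,t\in[0,1]$ and $n\in\mathbb N$, and $|g(q)-\beta(q,n)|\le 2^{-n}$ for all $q\in\mathbb Q\cap[0,1]$ and $n\in\mathbb N$. - A closed set $K\subset\mathcal M$ is *$\Pi_2$-computable* if there is a computable function $h$ with values in $\{0,1\}$ such that, for every non-empty word $w$ over $\mathcal A$ and every $r\in\mathbb Q$, $$K\cap\{\mu\in\mathcal M: d(\mu,\widehat{\delta_w})\le r\}\neq\emptyset\iff\forall y_1\in\mathbb N\ \exists y_2\in\mathbb N\ \ h(w,r,y_1,y_2)=1 .$$ **Proposition.** If $(F_\epsilon)_{\epsilon>0}$ is a computable perturbation of a cellular automaton such that $\mathcal M_{\lim}$ is uniformly approached, then $\mathcal M_{\lim}$ is (closed and) $\Pi_2$-computable. -/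

import Mathlib

open MeasureTheory ProbabilityTheory

noncomputable section

namespace NoisyCA

/-! ### Computability on metric spaces

An ideal (dense) sequence of a computable metric space is given as a map `z : ι → X` from a type of
codes `ι` with an effective enumeration (`Primcodable`). -/

/-- The rational number coded by `(a, b, c)`; every rational number has a code. -/
def ratOfCode (q : ℕ × ℕ × ℕ) : ℚ := ((q.1 : ℚ) - q.2.1) / (q.2.2 + 1)

/-- The ideal points of `[0,1]`: the code `(p, d)` stands for the rational `min p (d+1) / (d+1)`;
every element of `ℚ ∩ [0,1]` has a code. -/
def unitRat (q : ℕ × ℕ) : unitInterval :=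
  ⟨((min q.1 (q.2 + 1) : ℕ) : ℝ) / ((q.2 + 1 : ℕ) : ℝ),
    div_nonneg (Nat.cast_nonneg _) (Nat.cast_nonneg _),
    div_le_one_of_le₀ (Nat.cast_le.mpr (min_le_right _ _)) (Nat.cast_nonneg _)⟩

/-- A computable function between metric spaces with ideal points `z`, `z'`: it has a computable
modulus of uniform continuity, and its values at ideal points are uniformly computable. -/
def ComputableMap {X Y ι κ : Type*} [MetricSpace X] [MetricSpace Y] [Primcodable ι]
    [Primcodable κ] (z : ι → X) (z' : κ → Y) (F : X → Y) : Prop :=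
  ∃ (a : ℕ → ℕ) (b : ι × ℕ → κ), Computable a ∧ Computable b ∧
    (∀ (n : ℕ) (x y : X), dist x y ≤ (1 / 2 : ℝ) ^ a n → dist (F x) (F y) ≤ (1 / 2 : ℝ) ^ n) ∧
    ∀ (i : ι) (n : ℕ), dist (F (z i)) (z' (b (i, n))) ≤ (1 / 2 : ℝ) ^ n

/-- A closed set `K` is `Π₂`-computable if the relation "`K` meets the closed ball of ideal centre
`z i` and rational radius `r`" can be written `∀ y₁, ∃ y₂, f (i, r, y₁, y₂) = 1` with `f` a
computable Boolean function. -/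
def IsPi2Computable {X ι : Type*} [MetricSpace X] [Primcodable ι] (z : ι → X) (K : Set X) : Prop :=
  IsClosed K ∧ ∃ f : ι × (ℕ × ℕ × ℕ) × ℕ × ℕ → Bool, Computable f ∧
    ∀ (i : ι) (q : ℕ × ℕ × ℕ),
      (K ∩ Metric.closedBall (z i) (ratOfCode q : ℝ)).Nonempty ↔
        ∀ y₁ : ℕ, ∃ y₂ : ℕ, f (i, q, y₁, y₂) = true

/-! ### Shift-invariant probability measures on `A^ℤ` -/

section Measures

variable {A : Type*}

/-- The shift map, `σ(x)_i = x_{i+1}`. -/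
def shift (x : ℤ → A) : ℤ → A := fun i => x (i + 1)

/-- The cylinder of the pattern `u : A^U`. -/
def cyl (U : Finset ℤ) (u : U → A) : Set (ℤ → A) := {x | ∀ i : U, x i = u i}

lemma cyl_eq_preimage (U : Finset ℤ) (u : U → A) : cyl U u = U.restrict ⁻¹' ({u} : Set (U → A)) := by
  ext x
  exact ⟨fun h => funext h, fun h i => congrFun h i⟩

variable [MeasurableSpace A]

lemma measurable_restr (U : Finset ℤ) :
    Measurable (U.restrict : (ℤ → A) → U → A) :=
  measurable_pi_lambda _ fun i => measurable_pi_apply (i : ℤ)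

lemma measurable_shift : Measurable (shift : (ℤ → A) → ℤ → A) :=
  measurable_pi_lambda _ fun i => measurable_pi_apply (i + 1)

end Measures

/-- The set `M(A^ℤ)` of shift-invariant probability measures on `A^ℤ`. -/
structure InvMeasure (A : Type*) [MeasurableSpace A] where
  /-- the underlying measure -/
  meas : Measure (ℤ → A)
  prob : IsProbabilityMeasure meas
  shift_inv : meas.map shift = meas

attribute [instance] InvMeasure.prob

section Metric

variable {A : Type*} [MeasurableSpace A]

lemma InvMeasure.ext' {μ ν : InvMeasure A} (h : μ.meas = ν.meas) : μ = ν := by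
  cases μ; cases ν; cases h; rfl

variable [Fintype A]

/-- Total variation distance of `μ` and `ν` on the finite set of sites `U`. -/
def tvOn (U : Finset ℤ) (μ ν : InvMeasure A) : ℝ :=
  (1 / 2) * ∑ u : U → A, |μ.meas.real (cyl U u) - ν.meas.real (cyl U u)|

/-- The distance `d_M(μ, ν) = ∑ₙ 2⁻ⁿ ‖μ - ν‖_{[-n, n]}`. -/
def dM (μ ν : InvMeasure A) : ℝ :=
  ∑' n : ℕ, (1 / 2 : ℝ) ^ n * tvOn (Finset.Icc (-(n : ℤ)) n) μ ν

lemma tvOn_nonneg (U : Finset ℤ) (μ ν : InvMeasure A) : 0 ≤ tvOn U μ ν := by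
  unfold tvOn; positivity

variable [MeasurableSingletonClass A]

lemma sum_cyl (U : Finset ℤ) (μ : InvMeasure A) :
    ∑ u : U → A, μ.meas.real (cyl U u) = 1 := by
  have h1 : ∀ u : U → A, μ.meas.real (cyl U u) = (μ.meas.map U.restrict).real {u} := by
    intro u
    rw [cyl_eq_preimage, map_measureReal_apply (measurable_restr U) (measurableSet_singleton u)]
  have : IsProbabilityMeasure (μ.meas.map (U.restrict : (ℤ → A) → U → A)) :=
    Measure.isProbabilityMeasure_map (measurable_restr U).aemeasurable
  simp_rw [h1]
  rw [sum_measureReal_singleton]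
  simp

lemma tvOn_le_one (U : Finset ℤ) (μ ν : InvMeasure A) : tvOn U μ ν ≤ 1 := by
  unfold tvOn
  have : ∑ u : U → A, |μ.meas.real (cyl U u) - ν.meas.real (cyl U u)| ≤
      ∑ u : U → A, (μ.meas.real (cyl U u) + ν.meas.real (cyl U u)) := by
    refine Finset.sum_le_sum fun u _ => ?_
    rw [abs_le]
    constructor <;>
      linarith [measureReal_nonneg (μ := μ.meas) (s := cyl U u),
        measureReal_nonneg (μ := ν.meas) (s := cyl U u)]
  rw [Finset.sum_add_distrib, sum_cyl, sum_cyl] at this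
  linarith

lemma summable_dM (μ ν : InvMeasure A) :
    Summable fun n : ℕ => (1 / 2 : ℝ) ^ n * tvOn (Finset.Icc (-(n : ℤ)) n) μ ν := by
  refine Summable.of_nonneg_of_le (fun n => mul_nonneg (by positivity) (tvOn_nonneg _ _ _))
    (fun n => ?_) summable_geometric_two
  exact mul_le_of_le_one_right (by positivity) (tvOn_le_one _ _ _)

lemma eq_of_dM_eq_zero {μ ν : InvMeasure A} (h : dM μ ν = 0) : μ = ν := by
  apply InvMeasure.ext'
  have h0 : ∀ n : ℕ, tvOn (Finset.Icc (-(n : ℤ)) n) μ ν = 0 := by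
    intro n
    have hs := (summable_dM μ ν).hasSum
    rw [show ∑' n : ℕ, (1 / 2 : ℝ) ^ n * tvOn (Finset.Icc (-(n : ℤ)) n) μ ν = 0 from h] at hs
    have h6 := (hasSum_zero_iff_of_nonneg (fun k : ℕ =>
      mul_nonneg (pow_nonneg (by norm_num) k) (tvOn_nonneg _ _ _))).mp hs
    simpa using congrFun h6 n
  have h1 : ∀ n : ℕ, μ.meas.map (Finset.Icc (-(n : ℤ)) n).restrict =
      ν.meas.map (Finset.Icc (-(n : ℤ)) n).restrict := by
    intro n
    refine Measure.ext_of_singleton fun u => ?_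
    have h2 := h0 n
    unfold tvOn at h2
    have h3 : ∑ u : Finset.Icc (-(n : ℤ)) n → A,
        |μ.meas.real (cyl _ u) - ν.meas.real (cyl _ u)| = 0 := by linarith
    rw [Finset.sum_eq_zero_iff_of_nonneg (fun _ _ => abs_nonneg _)] at h3
    have h4 := sub_eq_zero.mp (abs_eq_zero.mp (h3 u (Finset.mem_univ u)))
    rw [Measure.map_apply (measurable_restr _) (measurableSet_singleton u),
      Measure.map_apply (measurable_restr _) (measurableSet_singleton u), ← cyl_eq_preimage]
    exact (measureReal_eq_measureReal_iff).mp h4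
  refine ext_of_generate_finite _ (generateFrom_measurableCylinders (α := fun _ : ℤ => A)).symm
    isPiSystem_measurableCylinders (fun s hs => ?_) (by simp)
  obtain ⟨I, S, hS, rfl⟩ := (mem_measurableCylinders _).mp hs
  obtain ⟨n, hn⟩ : ∃ n : ℕ, I ⊆ Finset.Icc (-(n : ℤ)) n := by
    refine ⟨I.sup Int.natAbs, fun i hi => ?_⟩
    have := Finset.le_sup (f := Int.natAbs) hi
    rw [Finset.mem_Icc]
    omega
  have hS' : MeasurableSet (Finset.restrict₂ (π := fun _ : ℤ => A) hn ⁻¹' S) :=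
    (measurable_pi_lambda _ fun i => measurable_pi_apply _) hS
  have h5 : cylinder (α := fun _ : ℤ => A) I S =
      (Finset.Icc (-(n : ℤ)) n).restrict ⁻¹' (Finset.restrict₂ (π := fun _ : ℤ => A) hn ⁻¹' S) := rfl
  rw [h5, ← Measure.map_apply (measurable_restr _) hS', h1 n,
    Measure.map_apply (measurable_restr _) hS']

/-- `M(A^ℤ)` with the distance `d_M`. -/
instance : MetricSpace (InvMeasure A) where
  dist := dM
  dist_self μ := by simp [dM, tvOn]
  dist_comm μ ν := by simp only [dM, tvOn, abs_sub_comm]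
  dist_triangle μ ν ρ := by
    unfold dM
    rw [← (summable_dM μ ν).tsum_add (summable_dM ν ρ)]
    refine (summable_dM μ ρ).tsum_le_tsum (fun n => ?_) ((summable_dM μ ν).add (summable_dM ν ρ))
    rw [← mul_add]
    refine mul_le_mul_of_nonneg_left ?_ (by positivity)
    unfold tvOn
    rw [← mul_add, ← Finset.sum_add_distrib]
    refine mul_le_mul_of_nonneg_left (Finset.sum_le_sum fun u _ => abs_sub_le _ _ _) (by norm_num)
  eq_of_dist_eq_zero := eq_of_dM_eq_zero

end Metric

/-! ### Measures supported by a periodic orbit -/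

section Periodic

variable {A : Type*}

/-- The periodic configuration `…www…` for the non-empty word `w = w.1 :: w.2`. -/
def periodicConf (w : A × List A) : ℤ → A := fun i =>
  (w.1 :: w.2).getD (i % ((w.2.length + 1 : ℕ) : ℤ)).toNat w.1

lemma shift_iterate_apply (k : ℕ) (x : ℤ → A) (i : ℤ) : (shift^[k] x) i = x (i + k) := by
  induction k generalizing i with
  | zero => simp
  | succ k ih =>
    rw [Function.iterate_succ_apply', shift, ih]
    congr 1
    push_cast
    ring

lemma shift_iterate_periodicConf (w : A × List A) :
    shift^[w.2.length + 1] (periodicConf w) = periodicConf w := by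
  funext i
  rw [shift_iterate_apply]
  simp [periodicConf]

variable [MeasurableSpace A]

/-- The shift-invariant probability measure supported by the periodic orbit generated by the
non-empty word `w = w.1 :: w.2`: the average of the Dirac masses along the orbit of `…www…`. -/
def periodicMeasure (w : A × List A) : InvMeasure A where
  meas := ((w.2.length + 1 : ℕ) : ENNReal)⁻¹ •
    ∑ k ∈ Finset.range (w.2.length + 1), Measure.dirac (shift^[k] (periodicConf w))
  prob := by
    constructor
    simp only [Measure.smul_apply, Measure.finsetSum_apply, measure_univ, Finset.sum_const,
      Finset.card_range, smul_eq_mul, nsmul_eq_mul, mul_one]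
    exact ENNReal.inv_mul_cancel (by simp) (ENNReal.natCast_ne_top _)
  shift_inv := by
    rw [Measure.map_smul]
    congr 1
    rw [← Measure.mapₗ_apply_of_measurable measurable_shift, map_sum]
    simp_rw [Measure.mapₗ_apply_of_measurable measurable_shift,
      Measure.map_dirac' measurable_shift, ← Function.iterate_succ_apply']
    rw [Finset.sum_range_succ, shift_iterate_periodicConf, Finset.sum_range_succ']
    simp

end Periodic

/-! ### Probabilistic cellular automata -/

/-- The local rule of a probabilistic cellular automaton with neighbourhood `N`: a stochastic matrix
`A^N × A → [0,1]`. -/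
structure StochRule (A : Type*) [Fintype A] (N : Finset ℤ) where
  /-- the matrix entries -/
  entry : (N → A) → A → unitInterval
  sum_entry : ∀ u, ∑ b, (entry u b : ℝ) = 1

section PCA

variable {A : Type*} [Fintype A] {N : Finset ℤ}

/-- The pattern `x_{i+N}` seen from the site `i`. -/
def window (N : Finset ℤ) (x : ℤ → A) (i : ℤ) : N → A := fun j => x (i + j)

variable [MeasurableSpace A]

/-- The law `φ(u, ·)` on `A`. -/
def siteLaw (φ : StochRule A N) (u : N → A) : Measure A :=
  ∑ b, ENNReal.ofReal (φ.entry u b) • Measure.dirac b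

instance (φ : StochRule A N) (u : N → A) : IsProbabilityMeasure (siteLaw φ u) := by
  constructor
  simp only [siteLaw, Measure.finsetSum_apply, Measure.smul_apply, measure_univ, smul_eq_mul,
    mul_one]
  rw [← ENNReal.ofReal_sum_of_nonneg (fun b _ => (φ.entry u b).2.1), φ.sum_entry,
    ENNReal.ofReal_one]

variable [MeasurableSingletonClass A]

lemma measurable_productLaw (φ : StochRule A N) :
    Measurable fun x : ℤ → A => Measure.infinitePi fun i => siteLaw φ (window N x i) := by
  refine Measurable.measure_of_isPiSystem_of_isProbabilityMeasure
    (generateFrom_squareCylinders (α := fun _ : ℤ => A)).symm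
    (isPiSystem_squareCylinders (fun _ => MeasurableSpace.isPiSystem_measurableSet) (by simp)) ?_
  rintro _ ⟨s, t, ht, rfl⟩
  have ht' : ∀ i, MeasurableSet (t i) := fun i => by simpa using ht i (Set.mem_univ i)
  simp_rw [Measure.infinitePi_pi _ (fun i _ => ht' i)]
  refine Finset.measurable_prod _ fun i _ => ?_
  have hw : Measurable fun x : ℤ → A => window N x i :=
    measurable_pi_lambda _ fun j => measurable_pi_apply (i + (j : ℤ))
  exact (measurable_of_countable fun u : N → A => siteLaw φ u (t i)).comp hw

/-- The transition kernel of the PCA: from `x`, the symbols at all sites `i` are drawn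
independently with laws `φ(x_{i+N}, ·)`. -/
def pcaKernel (φ : StochRule A N) : Kernel (ℤ → A) (ℤ → A) where
  toFun x := Measure.infinitePi fun i => siteLaw φ (window N x i)
  measurable' := measurable_productLaw φ

/-- The set of shift-invariant probability measures which are invariant under the PCA. -/
def invariantMeasures (φ : StochRule A N) : Set (InvMeasure A) :=
  {μ | (pcaKernel φ).Invariant μ.meas}

end PCA

/-! ### Perturbations of a cellular automaton and zero-noise limits -/

section Perturbation

variable {A : Type*} [Fintype A] {N : Finset ℤ}

/-- `φ`, a family of local rules indexed by `ε > 0`, is a perturbation of the cellular automaton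
with neighbourhood `N` and local rule `f`. -/
def IsPerturbation (f : (N → A) → A) (φ : Set.Ioi (0 : ℝ) → StochRule A N) : Prop :=
  ∀ (ε : Set.Ioi (0 : ℝ)) (u : N → A), 1 - (ε : ℝ) ≤ (φ ε).entry u (f u)

open Classical in
/-- The function `ε ↦ f_ε(u, b)` on `[0,1]`, where `f_0` is the deterministic rule `f`. -/
def ruleEntry (f : (N → A) → A) (φ : Set.Ioi (0 : ℝ) → StochRule A N) (u : N → A) (b : A)
    (ε : unitInterval) : unitInterval :=
  if h : 0 < (ε : ℝ) then (φ ⟨ε, h⟩).entry u b else if f u = b then 1 else 0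

/-- The perturbation is computable: `ε ↦ f_ε ∈ [0,1]^{A^N × A}` is computable on `[0,1]`. As
`A^N × A` is finite, this is computability of each of the entries. -/
def IsComputablePerturbation (f : (N → A) → A) (φ : Set.Ioi (0 : ℝ) → StochRule A N) : Prop :=
  ∀ (u : N → A) (b : A), ComputableMap unitRat unitRat (ruleEntry f φ u b)

end Perturbation

/-- Accumulation points, as `ε → 0`, of a family of sets indexed by `ε > 0`. -/
def acc {X : Type*} [MetricSpace X] (M : Set.Ioi (0 : ℝ) → Set X) : Set X :=
  {μ | ∀ δ > (0 : ℝ), ∀ ε₀ > (0 : ℝ), ∃ ε : Set.Ioi (0 : ℝ), (ε : ℝ) < ε₀ ∧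
    ∃ ν ∈ M ε, dist μ ν < δ}

section Limits

variable {A : Type*} [Fintype A] [MeasurableSpace A] [MeasurableSingletonClass A] {N : Finset ℤ}

/-- The set of zero-noise limits of invariant measures. -/
def zeroNoiseLimits (φ : Set.Ioi (0 : ℝ) → StochRule A N) : Set (InvMeasure A) :=
  acc fun ε => invariantMeasures (φ ε)

/-- The zero-noise limit set is uniformly approached: it is the set of accumulation points of every
family `π_ε` of invariant measures of the perturbed automata. -/
def UniformlyApproached (φ : Set.Ioi (0 : ℝ) → StochRule A N) : Prop :=
  ∀ π : Set.Ioi (0 : ℝ) → InvMeasure A, (∀ ε, π ε ∈ invariantMeasures (φ ε)) →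
    zeroNoiseLimits φ = acc fun ε => {π ε}

end Limits

end NoisyCA

end

/-! Write `p` for a periodic measure and `s` for a rational radius. The zero-noise limits meet the
closed ball of centre `p` and radius `s` exactly when, for every `n`, some `ε < 1/(n+1)` has all its
invariant measures within `s + 1/(n+1)` of `p`. If this failed at some `n`, then for every small `ε`
one could select an invariant measure far from `p`; by uniform approach the selected family would
still accumulate at every zero-noise limit, including the one in the ball
(`exists_invariantMeasures_subset_ball`). The converse is compactness of the space of
shift-invariant measures (`zeroNoiseLimits_inter_closedBall_nonempty`). It remains to see that the
inner condition is semi-decidable, which supplies the `∃ y₂` behind the `∀ y₁`.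

Shift-invariant measures are handled as functions on words. Since `|a - b| = a + b - 2 min a b`, the
distance is `2` minus a limit of the truncated `overlap`s, so closeness amounts to a lower bound on
an overlap. For a rule `ρ`, `empirical` averages the frequency of a word over the first `T + 1`
times and positions, starting from a long finite word. Two facts tie these averages to the invariant
measures. An invariant measure is a mixture of empirical averages, and the overlap is concave, so a
lower bound valid for all starting words passes to the measure (`le_overlap_of_wordInvariant`).
Conversely, limits of empirical averages are invariant, so a strict bound for all invariant measures
already holds for all empirical averages at some `T` (`IsLocalRule.exists_lt_overlap`).

The finite condition at time `T` is open and monotone in `ρ`. It therefore survives replacing `ρ` by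
a table of rational lower bounds, and checking it on such a table is enough. A certificate consists
of a rational `ε`, a precision, a time `T` and such a table. `Certificate.dist_le` and
`exists_certificate` give its soundness and its existence; the sections on primitive recursion show
that it can be checked effectively. -/

noncomputable section

namespace NoisyCA

/-! ### Words and local rules acting on words -/

section Words

variable {A : Type*}

/-- The indicator of the words in which `v` occurs at position `k`. -/
def occ (k : ℕ) (v y : List A) : ℝ := open Classical in if v <+: y.drop k then 1 else 0

lemma occ_nonneg (k : ℕ) (v y : List A) : 0 ≤ occ k v y := by
  unfold occ; split_ifs <;> norm_num

lemma occ_le_one (k : ℕ) (v y : List A) : occ k v y ≤ 1 := by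
  unfold occ; split_ifs <;> norm_num

lemma occ_nil (k : ℕ) (y : List A) : occ k [] y = 1 := by simp [occ]

lemma occ_succ_cons (k : ℕ) (v y : List A) (a : A) : occ (k + 1) v (a :: y) = occ k v y := by
  rw [occ, occ, List.drop_succ_cons]

open Classical in
lemma occ_zero_cons (v y : List A) (a b : A) :
    occ 0 (a :: v) (b :: y) = if a = b then occ 0 v y else 0 := by
  by_cases h : a = b <;> simp [occ, List.cons_prefix_cons, h]

lemma occ_eq_occ_zero (k : ℕ) (v y : List A) : occ k v y = occ 0 v (y.drop k) := by
  rw [occ, occ, List.drop_zero]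

/-- The probability weight with which the local rule `ρ` produces the word `y` from the word `x`;
the letter `y_i` is drawn according to `ρ (x_i x_{i+1} …)`. -/
def transition (ρ : List A → A → ℝ) : List A → List A → ℝ
  | _, [] => 1
  | x, b :: y => ρ x b * transition ρ x.tail y

lemma transition_nonneg {ρ : List A → A → ℝ} (hρ : ∀ z b, 0 ≤ ρ z b) (x y : List A) :
    0 ≤ transition ρ x y := by
  induction y generalizing x with
  | nil => simp [transition]
  | cons b y ih => exact mul_nonneg (hρ _ _) (ih _)

lemma transition_mono {ρ ρ' : List A → A → ℝ} (hρ : ∀ z b, 0 ≤ ρ z b) (h : ∀ z b, ρ z b ≤ ρ' z b)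
    (x y : List A) : transition ρ x y ≤ transition ρ' x y := by
  induction y generalizing x with
  | nil => simp [transition]
  | cons b y ih =>
    exact mul_le_mul (h _ _) (ih _) (transition_nonneg hρ _ _) ((hρ _ _).trans (h _ _))

lemma continuous_transition (x y : List A) :
    Continuous fun ρ : List A → A → ℝ => transition ρ x y := by
  induction y generalizing x with
  | nil => simpa [transition] using continuous_const
  | cons b y ih =>
    simp only [transition]
    exact (continuous_apply_apply x b).mul (ih _)

variable [Fintype A]

/-- The finite set of words of length `n`. -/
def wordSet (A : Type*) [Fintype A] (n : ℕ) : Finset (List A) := (List.finite_length_eq A n).toFinset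

@[simp] lemma mem_wordSet {n : ℕ} {v : List A} : v ∈ wordSet A n ↔ v.length = n := by
  simp [wordSet]

@[simp] lemma sum_wordSet_zero (h : List A → ℝ) : ∑ v ∈ wordSet A 0, h v = h [] := by
  have : wordSet A 0 = {[]} := by ext v; simp
  simp [this]

lemma sum_wordSet_succ (n : ℕ) (h : List A → ℝ) :
    ∑ v ∈ wordSet A (n + 1), h v = ∑ a, ∑ v ∈ wordSet A n, h (a :: v) := by
  rw [← Finset.sum_product']
  symm
  refine Finset.sum_bij (fun p _ => p.1 :: p.2) (by simp)
    (fun p _ q _ h => Prod.ext (List.cons.inj h).1 (List.cons.inj h).2) (fun v hv => ?_) (by simp)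
  cases v with
  | nil => simp at hv
  | cons a v => exact ⟨(a, v), by simpa using hv, rfl⟩

lemma sum_occ_mul (k n : ℕ) (y : List A) (h : List A → ℝ) (hn : k + n ≤ y.length) :
    ∑ v ∈ wordSet A n, occ k v y * h v = h ((y.drop k).take n) := by
  classical
  rw [Finset.sum_eq_single ((y.drop k).take n)]
  · simp [occ, List.take_prefix]
  · intro v hv hne
    rw [mem_wordSet] at hv
    have : ¬ v <+: y.drop k := fun hp => hne (by rw [← hv]; exact List.prefix_iff_eq_take.mp hp)
    simp [occ, this]
  · intro hv
    simp at hv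
    omega

/-- A shift-invariant probability measure as a function on words. -/
structure IsWordMeasure (M : List A → ℝ) : Prop where
  nonneg : ∀ v, 0 ≤ M v
  nil : M [] = 1
  sum_cons : ∀ v, ∑ a, M (a :: v) = M v
  sum_concat : ∀ v, ∑ a, M (v ++ [a]) = M v

/-! ### Marginals of word measures -/

namespace IsWordMeasure

variable {M : List A → ℝ}

lemma sum_append (hM : IsWordMeasure M) (v : List A) (n : ℕ) :
    ∑ u ∈ wordSet A n, M (v ++ u) = M v := by
  induction n generalizing v with
  | zero => simp
  | succ n ih =>
    rw [sum_wordSet_succ, ← hM.sum_concat v]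
    refine Finset.sum_congr rfl fun a _ => ?_
    rw [← ih (v ++ [a])]
    simp

lemma sum_eq_one (hM : IsWordMeasure M) (n : ℕ) : ∑ u ∈ wordSet A n, M u = 1 := by
  simpa [hM.nil] using hM.sum_append [] n

lemma le_one (hM : IsWordMeasure M) (v : List A) : M v ≤ 1 := by
  rw [← hM.sum_eq_one v.length]
  exact Finset.single_le_sum (fun u _ => hM.nonneg u) (by simp)

open Classical in
lemma sum_append_mul_occ (hM : IsWordMeasure M) (v u : List A) (n : ℕ) (hn : v.length ≤ n) :
    ∑ y ∈ wordSet A n, M (u ++ y) * occ 0 v y = M (u ++ v) := by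
  induction v generalizing u n with
  | nil => simpa [occ_nil] using hM.sum_append u n
  | cons a v ih =>
    obtain ⟨n, rfl⟩ : ∃ m, n = m + 1 := ⟨n - 1, by simp at hn; omega⟩
    rw [sum_wordSet_succ, Finset.sum_eq_single a]
    · simp_rw [occ_zero_cons]
      simpa using ih (u ++ [a]) n (by simpa using hn)
    · intro b _ hb
      simp [occ_zero_cons, hb.symm]
    · simp

/-- The `k` letters before the occurrence are summed out by consistency on the left, the letters
after it by consistency on the right. -/
lemma sum_mul_occ (hM : IsWordMeasure M) (k : ℕ) (v : List A) (n : ℕ) (hn : k + v.length ≤ n) :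
    ∑ y ∈ wordSet A n, M y * occ k v y = M v := by
  classical
  induction k generalizing n with
  | zero => simpa using hM.sum_append_mul_occ v [] n (by omega)
  | succ k ih =>
    obtain ⟨n, rfl⟩ : ∃ m, n = m + 1 := ⟨n - 1, by omega⟩
    rw [sum_wordSet_succ, Finset.sum_comm, ← ih n (by omega)]
    simp_rw [occ_succ_cons, ← Finset.sum_mul, hM.sum_cons]

end IsWordMeasure

/-- One step of the dynamics on functions of words, for a rule of radius `r`. -/
def markov (r : ℕ) (ρ : List A → A → ℝ) (h : List A → ℝ) (x : List A) : ℝ :=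
  ∑ y ∈ wordSet A (x.length - 2 * r), transition ρ x y * h y

lemma iterate_markov_nonneg {r : ℕ} {ρ : List A → A → ℝ} (hρ : ∀ z b, 0 ≤ ρ z b) (t : ℕ)
    {h : List A → ℝ} (hh : ∀ y, 0 ≤ h y) (x : List A) : 0 ≤ (markov r ρ)^[t] h x := by
  induction t generalizing x with
  | zero => exact hh x
  | succ t ih =>
    rw [Function.iterate_succ_apply']
    exact Finset.sum_nonneg fun y _ => mul_nonneg (transition_nonneg hρ _ _) (ih y)

lemma iterate_markov_mono {r : ℕ} {ρ ρ' : List A → A → ℝ} (hρ : ∀ z b, 0 ≤ ρ z b)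
    (hle : ∀ z b, ρ z b ≤ ρ' z b) (t : ℕ) {h : List A → ℝ} (hh : ∀ y, 0 ≤ h y) (x : List A) :
    (markov r ρ)^[t] h x ≤ (markov r ρ')^[t] h x := by
  induction t generalizing x with
  | zero => exact le_rfl
  | succ t ih =>
    rw [Function.iterate_succ_apply', Function.iterate_succ_apply']
    exact Finset.sum_le_sum fun y _ => mul_le_mul (transition_mono hρ hle _ _) (ih y)
      (iterate_markov_nonneg hρ t hh y) ((transition_nonneg hρ _ _).trans
        (transition_mono hρ hle _ _))

lemma continuous_iterate_markov (r t : ℕ) (h : List A → ℝ) (x : List A) :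
    Continuous fun ρ : List A → A → ℝ => (markov r ρ)^[t] h x := by
  induction t generalizing x with
  | zero => simpa using continuous_const
  | succ t ih =>
    simp_rw [Function.iterate_succ_apply']
    exact continuous_finsetSum _ fun y _ => (continuous_transition x y).mul (ih y)

/-- The empirical average of the frequencies of `v`, over the first `T + 1` steps and the first
`T + 1` positions, starting from `x`. -/
def empirical (r : ℕ) (ρ : List A → A → ℝ) (T : ℕ) (x v : List A) : ℝ :=
  ((T + 1 : ℝ) * (T + 1 : ℝ))⁻¹ *
    ∑ t ∈ Finset.range (T + 1), ∑ k ∈ Finset.range (T + 1), (markov r ρ)^[t] (occ k v) x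

/-- A length for which the empirical averages up to time `T` are not affected by the boundary. -/
def blockLength (r T : ℕ) : ℕ := (2 * r + 3) * (T + 1)

lemma empirical_nonneg {r : ℕ} {ρ : List A → A → ℝ} (hρ : ∀ z b, 0 ≤ ρ z b) (T : ℕ)
    (x v : List A) : 0 ≤ empirical r ρ T x v := by
  refine mul_nonneg (by positivity) (Finset.sum_nonneg fun t _ => Finset.sum_nonneg fun k _ => ?_)
  exact iterate_markov_nonneg hρ t (occ_nonneg k v) x

lemma empirical_mono {r : ℕ} {ρ ρ' : List A → A → ℝ} (hρ : ∀ z b, 0 ≤ ρ z b)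
    (hle : ∀ z b, ρ z b ≤ ρ' z b) (T : ℕ) (x v : List A) :
    empirical r ρ T x v ≤ empirical r ρ' T x v :=
  mul_le_mul_of_nonneg_left (Finset.sum_le_sum fun t _ => Finset.sum_le_sum fun k _ =>
    iterate_markov_mono hρ hle t (occ_nonneg k v) x) (by positivity)

lemma continuous_empirical (r T : ℕ) (x v : List A) :
    Continuous fun ρ : List A → A → ℝ => empirical r ρ T x v :=
  continuous_const.mul (continuous_finsetSum _ fun t _ => continuous_finsetSum _ fun _ _ =>
    continuous_iterate_markov r t _ x)

/-- The word measure `M` is invariant under the local rule `ρ`. -/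
def WordInvariant (r : ℕ) (ρ : List A → A → ℝ) (M : List A → ℝ) : Prop :=
  ∀ v, ∑ z ∈ wordSet A (v.length + 2 * r), M z * transition ρ z v = M v

/-- Duality: `M (P g) = (M P) g = M g`, iterated. Each step of the dynamics costs `2 r` letters,
hence the longer words on the left. -/
lemma WordInvariant.sum_mul_iterate_markov {r : ℕ} {ρ : List A → A → ℝ} {M : List A → ℝ}
    (h : WordInvariant r ρ M) (t n : ℕ) (g : List A → ℝ) :
    ∑ x ∈ wordSet A (n + 2 * r * t), M x * (markov r ρ)^[t] g x = ∑ y ∈ wordSet A n, M y * g y := by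
  induction t generalizing n with
  | zero => simp
  | succ t ih =>
    rw [show n + 2 * r * (t + 1) = (n + 2 * r * t) + 2 * r by ring, ← ih n]
    have h1 : ∀ x ∈ wordSet A ((n + 2 * r * t) + 2 * r),
        M x * (markov r ρ)^[t + 1] g x =
          ∑ y ∈ wordSet A (n + 2 * r * t), M x * transition ρ x y * (markov r ρ)^[t] g y := by
      intro x hx
      rw [mem_wordSet] at hx
      rw [Function.iterate_succ_apply', markov, hx, Nat.add_sub_cancel, Finset.mul_sum]
      simp_rw [mul_assoc]
    rw [Finset.sum_congr rfl h1, Finset.sum_comm]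
    refine Finset.sum_congr rfl fun y hy => ?_
    rw [mem_wordSet] at hy
    rw [← Finset.sum_mul, ← hy, h y]

/-- Each time `t` and position `k` contributes exactly `M v`. After `t ≤ T` steps at least `3 (T +
1)` letters remain, while an occurrence at `k ≤ T` of a word of length at most `2 T + 1` ends within
the first `3 T + 1`. Thus an invariant measure is a mixture of empirical averages. -/
lemma WordInvariant.sum_mul_empirical {r : ℕ} {ρ : List A → A → ℝ} {M : List A → ℝ}
    (hM : IsWordMeasure M) (h : WordInvariant r ρ M) (T : ℕ) (v : List A)
    (hv : v.length ≤ 2 * T + 1) :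
    ∑ x ∈ wordSet A (blockLength r T), M x * empirical r ρ T x v = M v := by
  have h1 : ∀ t ∈ Finset.range (T + 1), ∀ k ∈ Finset.range (T + 1),
      ∑ x ∈ wordSet A (blockLength r T), M x * (markov r ρ)^[t] (occ k v) x = M v := by
    intro t ht k hk
    rw [Finset.mem_range] at ht hk
    obtain ⟨s, hs⟩ : ∃ s, T = t + s := ⟨T - t, by omega⟩
    have h2 : blockLength r T = (2 * r * (s + 1) + 3 * (T + 1)) + 2 * r * t := by
      unfold blockLength; rw [hs]; ring
    rw [h2, h.sum_mul_iterate_markov]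
    refine hM.sum_mul_occ k v _ ?_
    have : 0 ≤ 2 * r * (s + 1) := Nat.zero_le _
    omega
  have h3 : ∀ x, M x * empirical r ρ T x v = ∑ t ∈ Finset.range (T + 1),
      ∑ k ∈ Finset.range (T + 1),
        ((T + 1 : ℝ) * (T + 1 : ℝ))⁻¹ * (M x * (markov r ρ)^[t] (occ k v) x) := by
    intro x
    simp_rw [empirical, Finset.mul_sum]
    exact Finset.sum_congr rfl fun _ _ => Finset.sum_congr rfl fun _ _ => by ring
  simp_rw [h3]
  rw [Finset.sum_comm]
  rw [Finset.sum_congr rfl fun t ht => Finset.sum_comm]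
  simp_rw [← Finset.mul_sum]
  rw [Finset.sum_congr rfl fun t ht => Finset.sum_congr rfl fun k hk => h1 t ht k hk]
  simp
  field_simp

/-- The truncated overlap of two word measures. -/
def overlap (n : ℕ) (p q : List A → ℝ) : ℝ :=
  ∑ m ∈ Finset.range (n + 1), (1 / 2 : ℝ) ^ m * ∑ v ∈ wordSet A (2 * m + 1), min (p v) (q v)

lemma overlap_mono_left (n : ℕ) {p p' : List A → ℝ} (q : List A → ℝ)
    (h : ∀ v, v.length ≤ 2 * n + 1 → p v ≤ p' v) : overlap n p q ≤ overlap n p' q := by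
  refine Finset.sum_le_sum fun m hm => mul_le_mul_of_nonneg_left (Finset.sum_le_sum fun v hv => ?_)
    (by positivity)
  rw [Finset.mem_range] at hm
  rw [mem_wordSet] at hv
  exact min_le_min_right _ (h v (by omega))

lemma overlap_mono {n n' : ℕ} (h : n ≤ n') {p q : List A → ℝ} (hp : ∀ v, 0 ≤ p v)
    (hq : ∀ v, 0 ≤ q v) : overlap n p q ≤ overlap n' p q := by
  refine Finset.sum_le_sum_of_subset_of_nonneg (Finset.range_subset_range.mpr (by omega))
    fun _ _ _ => mul_nonneg (by positivity) (Finset.sum_nonneg fun v _ => le_min (hp v) (hq v))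

lemma continuous_overlap (n : ℕ) (q : List A → ℝ) :
    Continuous fun p : List A → ℝ => overlap n p q :=
  continuous_finsetSum _ fun _ _ => continuous_const.mul <|
    continuous_finsetSum _ fun v _ => (continuous_apply v).min continuous_const

/-- Jensen's inequality: `min · (q v)` is concave and the weights `M x` sum to one. -/
lemma sum_mul_overlap_le {M : List A → ℝ} (n R : ℕ) (p : List A → List A → ℝ)
    (q : List A → ℝ) (hM : IsWordMeasure M) :
    ∑ x ∈ wordSet A R, M x * overlap n (p x) q ≤
      overlap n (fun v => ∑ x ∈ wordSet A R, M x * p x v) q := by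
  have h1 : ∀ x, M x * overlap n (p x) q = ∑ m ∈ Finset.range (n + 1),
      ∑ v ∈ wordSet A (2 * m + 1), (1 / 2 : ℝ) ^ m * (M x * min (p x v) (q v)) := by
    intro x
    simp_rw [overlap, Finset.mul_sum]
    exact Finset.sum_congr rfl fun _ _ => Finset.sum_congr rfl fun _ _ => by ring
  simp_rw [h1]
  rw [Finset.sum_comm]
  refine Finset.sum_le_sum fun m _ => ?_
  rw [Finset.sum_comm, Finset.mul_sum]
  refine Finset.sum_le_sum fun v _ => ?_
  rw [← Finset.mul_sum]
  refine mul_le_mul_of_nonneg_left (le_min ?_ ?_) (by positivity)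
  · exact Finset.sum_le_sum fun x _ => mul_le_mul_of_nonneg_left (min_le_left _ _) (hM.nonneg x)
  · calc ∑ x ∈ wordSet A R, M x * min (p x v) (q v) ≤ ∑ x ∈ wordSet A R, M x * q v :=
          Finset.sum_le_sum fun x _ => mul_le_mul_of_nonneg_left (min_le_right _ _) (hM.nonneg x)
      _ = q v := by rw [← Finset.sum_mul, hM.sum_eq_one, one_mul]

/-- A lower bound on the overlaps of all empirical averages of a rule `ρ' ≤ ρ` holds for all
invariant measures of `ρ`. -/
lemma le_overlap_of_wordInvariant {r : ℕ} {ρ ρ' : List A → A → ℝ} {M q : List A → ℝ}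
    (hρ : ∀ z b, 0 ≤ ρ' z b) (hle : ∀ z b, ρ' z b ≤ ρ z b)
    (hM : IsWordMeasure M) (h : WordInvariant r ρ M) (T : ℕ) (c : ℝ)
    (hc : ∀ x, x.length = blockLength r T → c ≤ overlap T (empirical r ρ' T x) q) :
    c ≤ overlap T M q := by
  calc c = ∑ x ∈ wordSet A (blockLength r T), M x * c := by
        rw [← Finset.sum_mul, hM.sum_eq_one, one_mul]
    _ ≤ ∑ x ∈ wordSet A (blockLength r T), M x * overlap T (empirical r ρ' T x) q :=
        Finset.sum_le_sum fun x hx => mul_le_mul_of_nonneg_left (hc x (by simpa using hx))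
          (hM.nonneg x)
    _ ≤ ∑ x ∈ wordSet A (blockLength r T), M x * overlap T (empirical r ρ T x) q :=
        Finset.sum_le_sum fun x hx => mul_le_mul_of_nonneg_left
          (overlap_mono_left T q fun v _ => empirical_mono hρ hle T x v) (hM.nonneg x)
    _ ≤ _ := sum_mul_overlap_le T _ _ q hM
    _ ≤ _ := overlap_mono_left T q fun v hv => (h.sum_mul_empirical hM T v hv).le

end Words

/-! ### Limits of empirical averages -/

section WordLimits

open Filter Topology

variable {A : Type*}

/-- Tychonoff's theorem for `[0,1]` to the power of the set of words; limits along a fixed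
ultrafilter take the place of subsequences. -/
lemma exists_tendsto_hyperfilter (p : ℕ → List A → ℝ) (h0 : ∀ n v, 0 ≤ p n v)
    (h1 : ∀ n v, p n v ≤ 1) : ∃ M, Tendsto p (hyperfilter ℕ) (𝓝 M) := by
  have hc : IsCompact (Set.pi Set.univ fun _ : List A => Set.Icc (0 : ℝ) 1) :=
    isCompact_univ_pi fun _ => isCompact_Icc
  obtain ⟨M, -, hM⟩ := hc.ultrafilter_le_nhds ((hyperfilter ℕ).map p) (by
    rw [le_principal_iff]
    exact Filter.Eventually.of_forall (f := (hyperfilter ℕ : Filter ℕ))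
      fun n v _ => ⟨h0 n v, h1 n v⟩)
  exact ⟨M, hM⟩

lemma hyperfilter_le_atTop : (hyperfilter ℕ : Filter ℕ) ≤ atTop := by
  rw [← Nat.cofinite_eq_atTop]; exact hyperfilter_le_cofinite

variable [Fintype A]

/-- `ρ` is a stochastic rule reading only the first `2 r + 1` letters. -/
structure IsLocalRule (r : ℕ) (ρ : List A → A → ℝ) : Prop where
  nonneg : ∀ z b, 0 ≤ ρ z b
  sum_eq_one : ∀ z, ∑ b, ρ z b = 1
  take : ∀ z b, ρ (z.take (2 * r + 1)) b = ρ z b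

lemma sum_occ_cons (k : ℕ) (v y : List A) (h : k < y.length) :
    ∑ a, occ k (a :: v) y = occ (k + 1) v y := by
  classical
  rw [occ_eq_occ_zero (k + 1), ← List.tail_drop]
  simp_rw [occ_eq_occ_zero k]
  obtain ⟨b, z, hz⟩ : ∃ b z, y.drop k = b :: z := by
    cases hd : y.drop k with
    | nil => simp at hd; omega
    | cons b z => exact ⟨b, z, rfl⟩
  simp [hz, occ_zero_cons]

lemma sum_occ_concat (k : ℕ) (v y : List A) (h : k + v.length < y.length) :
    ∑ a, occ k (v ++ [a]) y = occ k v y := by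
  classical
  simp_rw [occ_eq_occ_zero k]
  have h' : v.length < (y.drop k).length := by simp; omega
  generalize y.drop k = z at h'
  clear h
  induction v generalizing z with
  | nil => simpa [occ_nil] using sum_occ_cons 0 [] z (by simpa using h')
  | cons b v ih =>
    cases z with
    | nil => simp at h'
    | cons c z =>
      simp only [List.cons_append, occ_zero_cons]
      by_cases hbc : b = c
      · simpa [hbc] using ih z (by simpa using h')
      · simp [hbc]

namespace IsLocalRule

variable {r : ℕ} {ρ : List A → A → ℝ}

lemma sum_transition_mul_occ_zero (hρ : IsLocalRule r ρ) (x v : List A) (n : ℕ)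
    (hn : v.length ≤ n) :
    ∑ y ∈ wordSet A n, transition ρ x y * occ 0 v y = transition ρ x v := by
  classical
  induction n generalizing x v with
  | zero =>
    have : v = [] := by simpa using hn
    simp [this, occ_nil]
  | succ n ih =>
    rw [sum_wordSet_succ]
    cases v with
    | nil =>
      simp only [transition, mul_assoc, ← Finset.mul_sum]
      have : ∀ b, ∑ y ∈ wordSet A n, transition ρ x.tail y * occ 0 [] (b :: y) = 1 := by
        intro b
        simpa [occ_nil, transition] using ih x.tail [] (by simp)
      simp [this, hρ.sum_eq_one]
    | cons a v =>
      rw [Finset.sum_eq_single a]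
      · simp only [occ_zero_cons, transition, mul_assoc, ← Finset.mul_sum]
        simp [ih x.tail v (by simpa using hn)]
      · intro b _ hb
        simp [occ_zero_cons, hb.symm]
      · simp

/-- The letters outside the occurrence are summed out because the rows of `ρ` have mass one. -/
lemma sum_transition_mul_occ (hρ : IsLocalRule r ρ) (k : ℕ) (x v : List A) (n : ℕ)
    (hn : k + v.length ≤ n) :
    ∑ y ∈ wordSet A n, transition ρ x y * occ k v y = transition ρ (x.drop k) v := by
  induction k generalizing x n with
  | zero => simpa using hρ.sum_transition_mul_occ_zero x v n (by omega)
  | succ k ih =>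
    obtain ⟨n, rfl⟩ : ∃ m, n = m + 1 := ⟨n - 1, by omega⟩
    rw [sum_wordSet_succ]
    simp only [occ_succ_cons, transition, mul_assoc, ← Finset.mul_sum]
    simp_rw [ih x.tail n (by omega), ← Finset.sum_mul, hρ.sum_eq_one, List.drop_tail, one_mul]

lemma sum_transition (hρ : IsLocalRule r ρ) (x : List A) (n : ℕ) :
    ∑ y ∈ wordSet A n, transition ρ x y = 1 := by
  simpa [occ_nil, transition] using hρ.sum_transition_mul_occ_zero x [] n (by simp)

lemma transition_take (hρ : IsLocalRule r ρ) (x v : List A) :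
    transition ρ (x.take (v.length + 2 * r)) v = transition ρ x v := by
  induction v generalizing x with
  | nil => simp [transition]
  | cons b v ih =>
    simp only [transition, List.length_cons]
    rw [← hρ.take, List.take_take, min_eq_left (by omega), hρ.take,
      show v.length + 1 + 2 * r = (v.length + 2 * r) + 1 by ring, ← List.drop_one, List.drop_take,
      Nat.add_sub_cancel, List.drop_one, ih]

/-- The letters of `v` at time one depend only on the block of length `|v| + 2 r` at the same
position at time zero. This expresses the defect of invariance of an empirical average as a
difference between consecutive times. -/
lemma markov_occ (hρ : IsLocalRule r ρ) (k : ℕ) (v y : List A)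
    (hy : k + v.length + 2 * r ≤ y.length) :
    markov r ρ (occ k v) y =
      ∑ z ∈ wordSet A (v.length + 2 * r), transition ρ z v * occ k z y := by
  rw [markov, hρ.sum_transition_mul_occ k y v _ (by omega)]
  simp_rw [mul_comm _ (occ k _ y)]
  rw [sum_occ_mul k _ y (fun z => transition ρ z v) (by omega), hρ.transition_take]

lemma iterate_markov_le_one (hρ : IsLocalRule r ρ) (t : ℕ) {h : List A → ℝ} (hh : ∀ y, h y ≤ 1)
    (x : List A) : (markov r ρ)^[t] h x ≤ 1 := by
  induction t generalizing x with
  | zero => exact hh x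
  | succ t ih =>
    rw [Function.iterate_succ_apply', ← hρ.sum_transition x (x.length - 2 * r)]
    exact Finset.sum_le_sum fun y _ =>
      mul_le_of_le_one_right (transition_nonneg hρ.nonneg _ _) (ih y)

end IsLocalRule

/-! ### Approximate consistency and invariance of empirical averages -/

lemma iterate_markov_sum (r : ℕ) (ρ : List A → A → ℝ) (t : ℕ) {ι : Type*} (s : Finset ι)
    (c : ι → ℝ) (h : ι → List A → ℝ) (x : List A) :
    (markov r ρ)^[t] (fun y => ∑ i ∈ s, c i * h i y) x =
      ∑ i ∈ s, c i * (markov r ρ)^[t] (h i) x := by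
  induction t generalizing x with
  | zero => rfl
  | succ t ih =>
    simp only [Function.iterate_succ_apply', markov]
    simp_rw [ih, Finset.mul_sum]
    rw [Finset.sum_comm]
    exact Finset.sum_congr rfl fun _ _ => Finset.sum_congr rfl fun _ _ => by ring

/-- Needed because the identities for `occ` fail on words that are too short: only the length
reached after `t` steps matters. -/
lemma iterate_markov_congr (r : ℕ) (ρ : List A → A → ℝ) (t n : ℕ) {h h' : List A → ℝ}
    (hh : ∀ y, y.length = n → h y = h' y) (x : List A) (hx : x.length = n + 2 * r * t) :
    (markov r ρ)^[t] h x = (markov r ρ)^[t] h' x := by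
  induction t generalizing x with
  | zero => exact hh x (by simpa using hx)
  | succ t ih =>
    simp only [Function.iterate_succ_apply', markov]
    refine Finset.sum_congr rfl fun y hy => ?_
    rw [mem_wordSet, hx] at hy
    rw [ih y (by rw [hy, Nat.mul_succ]; omega)]

/-- The `n` letters left at time `t` accommodate a position `k ≤ T`, a word of length at most `T`,
one further letter, and the `2 r` letters used by one more step. -/
lemma exists_blockLength_eq (r T t : ℕ) (ht : t ≤ T) :
    ∃ n, blockLength r T = n + 2 * r * t ∧ 2 * T + 2 * r + 1 ≤ n := by
  obtain ⟨s, rfl⟩ : ∃ s, T = t + s := ⟨T - t, by omega⟩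
  refine ⟨2 * r * (s + 1) + 3 * (t + s + 1), by unfold blockLength; ring, ?_⟩
  have : 2 * r * (s + 1) = 2 * r * s + 2 * r := by ring
  omega

/-- Each of the `T + 1` inner sums telescopes to a difference of two numbers in `[0,1]`, against a
normalisation by `(T + 1)²`. -/
lemma abs_telescope_le (T : ℕ) (e : ℕ → ℕ → ℝ) (h0 : ∀ t k, 0 ≤ e t k) (h1 : ∀ t k, e t k ≤ 1) :
    |((T + 1 : ℝ) * (T + 1 : ℝ))⁻¹ * ∑ t ∈ Finset.range (T + 1), ∑ k ∈ Finset.range (T + 1),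
      (e t (k + 1) - e t k)| ≤ 1 / ((T : ℝ) + 1) := by
  have h2 : |∑ t ∈ Finset.range (T + 1), ∑ k ∈ Finset.range (T + 1), (e t (k + 1) - e t k)| ≤
      T + 1 := by
    refine (Finset.abs_sum_le_sum_abs _ _).trans ?_
    calc _ ≤ ∑ t ∈ Finset.range (T + 1), (1 : ℝ) := Finset.sum_le_sum fun t _ => by
            rw [Finset.sum_range_sub, abs_le]
            constructor <;> linarith [h0 t 0, h1 t 0, h0 t (T + 1), h1 t (T + 1)]
      _ = _ := by simp
  have hT : (0 : ℝ) < T + 1 := by positivity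
  rw [abs_mul, abs_of_nonneg (by positivity)]
  calc _ ≤ ((T + 1 : ℝ) * (T + 1 : ℝ))⁻¹ * (T + 1) := mul_le_mul_of_nonneg_left h2 (by positivity)
    _ = _ := by field_simp

variable {r : ℕ} {ρ : List A → A → ℝ}

lemma IsLocalRule.iterate_markov_occ_nil (hρ : IsLocalRule r ρ) (t k : ℕ) (x : List A) :
    (markov r ρ)^[t] (occ k []) x = 1 := by
  induction t generalizing x with
  | zero => exact occ_nil k x
  | succ t ih =>
    rw [Function.iterate_succ_apply', markov]
    simp [ih, hρ.sum_transition]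

lemma IsLocalRule.empirical_nil (hρ : IsLocalRule r ρ) (T : ℕ) (x : List A) :
    empirical r ρ T x [] = 1 := by
  simp [empirical, hρ.iterate_markov_occ_nil]
  field_simp

/-- Exact, unlike consistency on the left: appending a letter does not move the position `k` of the
occurrence. -/
lemma sum_empirical_concat (T : ℕ) (x v : List A)
    (hx : x.length = blockLength r T) (hv : v.length ≤ T) :
    ∑ a, empirical r ρ T x (v ++ [a]) = empirical r ρ T x v := by
  simp_rw [empirical, ← Finset.mul_sum]
  rw [Finset.sum_comm]
  simp_rw [Finset.sum_comm (s := Finset.univ)]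
  congr 1
  refine Finset.sum_congr rfl fun t ht => Finset.sum_congr rfl fun k hk => ?_
  rw [Finset.mem_range] at ht hk
  obtain ⟨n, hn, hn'⟩ := exists_blockLength_eq r T t (by omega)
  have := iterate_markov_sum r ρ t Finset.univ (fun _ : A => 1) (fun a => occ k (v ++ [a])) x
  simp only [one_mul] at this
  rw [← this]
  exact iterate_markov_congr r ρ t n (fun y hy => sum_occ_concat k v y (by omega)) x (by omega)

/-- Summing out the first letter turns an occurrence at `k` into one at `k + 1`, so the defect
telescopes over positions. -/
lemma IsLocalRule.abs_sum_empirical_cons (hρ : IsLocalRule r ρ) (T : ℕ) (x v : List A)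
    (hx : x.length = blockLength r T) :
    |∑ a, empirical r ρ T x (a :: v) - empirical r ρ T x v| ≤ 1 / ((T : ℝ) + 1) := by
  convert abs_telescope_le T (fun t k => (markov r ρ)^[t] (occ k v) x)
    (fun t k => iterate_markov_nonneg hρ.nonneg t (occ_nonneg k v) x)
    (fun t k => hρ.iterate_markov_le_one t (occ_le_one k v) x) using 2
  simp_rw [empirical, ← Finset.mul_sum]
  rw [Finset.sum_comm]
  simp_rw [Finset.sum_comm (s := Finset.univ)]
  rw [← mul_sub]
  simp_rw [← Finset.sum_sub_distrib]
  congr 1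
  refine Finset.sum_congr rfl fun t ht => Finset.sum_congr rfl fun k hk => ?_
  rw [Finset.mem_range] at ht hk
  obtain ⟨n, hn, hn'⟩ := exists_blockLength_eq r T t (by omega)
  have := iterate_markov_sum r ρ t Finset.univ (fun _ : A => 1) (fun a => occ k (a :: v)) x
  simp only [one_mul] at this
  rw [← this]
  congr 1
  exact iterate_markov_congr r ρ t n (fun y hy => sum_occ_cons k v y (by omega)) x (by omega)

/-- By `markov_occ`, applying the rule turns time `t` into `t + 1`, so the defect telescopes over
times. -/
lemma IsLocalRule.abs_sum_empirical_transition (hρ : IsLocalRule r ρ) (T : ℕ) (x v : List A)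
    (hx : x.length = blockLength r T) (hv : v.length ≤ T) :
    |∑ z ∈ wordSet A (v.length + 2 * r), empirical r ρ T x z * transition ρ z v
      - empirical r ρ T x v| ≤ 1 / ((T : ℝ) + 1) := by
  -- The roles of time and position are exchanged: the telescoping index is now `t`.
  convert abs_telescope_le T (fun k t => (markov r ρ)^[t] (occ k v) x)
    (fun k t => iterate_markov_nonneg hρ.nonneg t (occ_nonneg k v) x)
    (fun k t => hρ.iterate_markov_le_one t (occ_le_one k v) x) using 2
  rw [Finset.sum_comm]
  simp_rw [empirical, mul_assoc, ← Finset.mul_sum, Finset.sum_mul]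
  rw [Finset.sum_comm]
  simp_rw [Finset.sum_comm (s := wordSet A _)]
  rw [← mul_sub]
  simp_rw [← Finset.sum_sub_distrib]
  congr 1
  refine Finset.sum_congr rfl fun t ht => Finset.sum_congr rfl fun k hk => ?_
  rw [Finset.mem_range] at ht hk
  obtain ⟨n, hn, hn'⟩ := exists_blockLength_eq r T t (by omega)
  have := iterate_markov_sum r ρ t (wordSet A (v.length + 2 * r)) (fun z => transition ρ z v)
    (fun z => occ k z) x
  simp_rw [mul_comm _ (transition ρ _ v)]
  rw [← this, Function.iterate_succ_apply]
  congr 1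
  exact (iterate_markov_congr r ρ t n (fun y hy => hρ.markov_occ k v y (by omega)) x
    (by omega)).symm

lemma IsWordMeasure.of_tendsto {𝒰 : Filter ℕ} [𝒰.NeBot] {p : ℕ → List A → ℝ} {M : List A → ℝ}
    (h : Tendsto p 𝒰 (𝓝 M)) (h0 : ∀ n v, 0 ≤ p n v) (h1 : ∀ n, p n [] = 1)
    (h2 : ∀ v, Tendsto (fun n => ∑ a, p n (a :: v) - p n v) 𝒰 (𝓝 0))
    (h3 : ∀ v, Tendsto (fun n => ∑ a, p n (v ++ [a]) - p n v) 𝒰 (𝓝 0)) : IsWordMeasure M := by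
  have hv : ∀ v, Tendsto (fun n => p n v) 𝒰 (𝓝 (M v)) := tendsto_pi_nhds.mp h
  refine ⟨fun v => ge_of_tendsto' (hv v) fun n => h0 n v, ?_, fun v => ?_, fun v => ?_⟩
  · exact tendsto_nhds_unique (hv []) (by simp [h1])
  · have := tendsto_nhds_unique (h2 v) ((tendsto_finsetSum _ fun a _ => hv (a :: v)).sub (hv v))
    linarith
  · have := tendsto_nhds_unique (h3 v) ((tendsto_finsetSum _ fun a _ => hv (v ++ [a])).sub (hv v))
    linarith

/-- Empirical averages accumulate at invariant word measures. -/
lemma IsLocalRule.exists_limit (hρ : IsLocalRule r ρ) (x : ℕ → List A)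
    (hx : ∀ T, (x T).length = blockLength r T) :
    ∃ M, IsWordMeasure M ∧ WordInvariant r ρ M ∧
      Tendsto (fun T => empirical r ρ T (x T)) (hyperfilter ℕ) (𝓝 M) := by
  have h0 : ∀ T v, 0 ≤ empirical r ρ T (x T) v := fun T v => empirical_nonneg hρ.nonneg T _ v
  have h1 : ∀ T v, empirical r ρ T (x T) v ≤ 1 := by
    intro T v
    rw [← hρ.empirical_nil T (x T)]
    refine mul_le_mul_of_nonneg_left (Finset.sum_le_sum fun t _ => Finset.sum_le_sum fun k _ => ?_)
      (by positivity)
    rw [hρ.iterate_markov_occ_nil]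
    exact hρ.iterate_markov_le_one t (occ_le_one k v) (x T)
  obtain ⟨M, hM⟩ := exists_tendsto_hyperfilter _ h0 h1
  -- Every defect is at most `1 / (T + 1)` once `T` exceeds the length of the word, so it vanishes
  -- in the limit.
  have hlim : ∀ {g : ℕ → ℝ} (n : ℕ), (∀ T, n ≤ T → |g T| ≤ 1 / ((T : ℝ) + 1)) →
      Tendsto g (hyperfilter ℕ) (𝓝 0) := by
    intro g n hg
    refine Tendsto.mono_left ?_ hyperfilter_le_atTop
    exact squeeze_zero_norm' (eventually_atTop.mpr ⟨n, hg⟩) tendsto_one_div_add_atTop_nhds_zero_nat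
  refine ⟨M, IsWordMeasure.of_tendsto hM h0 (fun T => hρ.empirical_nil T _) (fun v => ?_)
    (fun v => ?_), fun v => ?_, hM⟩
  · exact hlim 0 fun T _ => hρ.abs_sum_empirical_cons T _ v (hx T)
  · refine hlim v.length fun T hT => ?_
    rw [sum_empirical_concat T _ v (hx T) hT, sub_self, abs_zero]
    positivity
  · have hv : ∀ v, Tendsto (fun n => empirical r ρ n (x n) v) (hyperfilter ℕ) (𝓝 (M v)) :=
      tendsto_pi_nhds.mp hM
    have := tendsto_nhds_unique
      (hlim v.length fun T hT => hρ.abs_sum_empirical_transition T _ v (hx T) hT)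
      ((tendsto_finsetSum _ fun z _ => (hv z).mul_const _).sub (hv v))
    linarith

/-- If all invariant word measures of `ρ` overlap with `q` by more than `c`, then so do the
empirical averages at some time. -/
lemma IsLocalRule.exists_lt_overlap (hρ : IsLocalRule r ρ) (q : List A → ℝ) (hq : ∀ v, 0 ≤ q v)
    (c : ℝ) (h : ∀ M, IsWordMeasure M → WordInvariant r ρ M → ∃ n, c < overlap n M q) :
    ∃ T, ∀ x, x.length = blockLength r T → c < overlap T (empirical r ρ T x) q := by
  -- Otherwise there is a bad starting word for each `T`, and the limit `M` of their empirical
  -- averages is an invariant word measure.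
  by_contra! hc
  choose x hx hxc using hc
  obtain ⟨M, hM, hinv, hlim⟩ := hρ.exists_limit x hx
  obtain ⟨n, hn⟩ := h M hM hinv
  refine absurd hn (not_lt.mpr ?_)
  refine le_of_tendsto (((continuous_overlap n q).tendsto M).comp hlim) ?_
  -- For fixed `n`, the overlap at level `n` is at most the one at level `T ≥ n`, which is at most
  -- `c`; this bound passes to the limit.
  refine hyperfilter_le_atTop (eventually_atTop.mpr ⟨n, fun T hT => ?_⟩)
  exact (overlap_mono hT (fun v => empirical_nonneg hρ.nonneg T _ v) hq).trans (hxc T)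

end WordLimits

/-! ### Shift-invariant measures and word measures -/

section WordCylinders

open Filter Topology

set_option linter.unusedSectionVars false

variable {A : Type*}

/-- The configurations in which the word `v` occurs at position `j`. -/
def wordCyl : ℤ → List A → Set (ℤ → A)
  | _, [] => Set.univ
  | j, a :: v => {x | x j = a} ∩ wordCyl (j + 1) v

lemma mem_wordCyl {j : ℤ} {v : List A} {x : ℤ → A} :
    x ∈ wordCyl j v ↔ ∀ (i : ℕ) (h : i < v.length), x (j + i) = v[i] := by
  induction v generalizing j with
  | nil => simp [wordCyl]
  | cons a v ih =>
    simp only [wordCyl, Set.mem_inter_iff, Set.mem_ofPred_eq, ih]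
    constructor
    · rintro ⟨h0, h⟩ i hi
      cases i with
      | zero => simpa using h0
      | succ i =>
        have := h i (by simpa using hi)
        rw [add_assoc, add_comm (1 : ℤ)] at this
        simpa using this
    · refine fun h => ⟨(congrArg x (by simp)).trans (h 0 (by simp)),
        fun i hi => ?_⟩
      have := h (i + 1) (by simpa using hi)
      rw [add_assoc, add_comm (1 : ℤ)]
      simpa using this

lemma wordCyl_append (j : ℤ) (u v : List A) :
    wordCyl j (u ++ v) = wordCyl j u ∩ wordCyl (j + u.length) v := by
  induction u generalizing j with
  | nil => simp [wordCyl]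
  | cons a u ih =>
    simp only [List.cons_append, wordCyl, ih, Set.inter_assoc, List.length_cons]
    rw [show j + ((u.length + 1 : ℕ) : ℤ) = j + 1 + u.length by push_cast; ring]

lemma shift_preimage_wordCyl (j : ℤ) (v : List A) :
    shift ⁻¹' wordCyl j v = wordCyl (j + 1) v := by
  induction v generalizing j with
  | nil => rfl
  | cons a v ih =>
    rw [wordCyl, wordCyl, Set.preimage_inter, ih]
    rfl

lemma isClopen_wordCyl [TopologicalSpace A] [DiscreteTopology A] (j : ℤ) (v : List A) :
    IsClopen (wordCyl j v) := by
  induction v generalizing j with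
  | nil => exact isClopen_univ
  | cons a v ih =>
    exact IsClopen.inter ((isClopen_discrete {a}).preimage (continuous_apply j)) (ih _)

variable [MeasurableSpace A] [MeasurableSingletonClass A]

lemma measurableSet_wordCyl (j : ℤ) (v : List A) : MeasurableSet (wordCyl j v) := by
  induction v generalizing j with
  | nil => exact MeasurableSet.univ
  | cons a v ih =>
    exact (measurable_pi_apply j (measurableSet_singleton a)).inter (ih _)

variable [Fintype A]

lemma sum_measureReal_inter (μ : Measure (ℤ → A)) [IsFiniteMeasure μ] (i : ℤ) (S : Set (ℤ → A)) :
    ∑ a, μ.real ({x | x i = a} ∩ S) = μ.real S := by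
  have h := sum_measureReal_preimage_singleton (μ := μ.restrict S) (f := fun x : ℤ → A => x i)
    Finset.univ fun a _ => measurable_pi_apply i (measurableSet_singleton a)
  have h2 : ∀ a, (μ.restrict S).real ((fun x : ℤ → A => x i) ⁻¹' {a}) =
      μ.real ({x | x i = a} ∩ S) := fun a =>
    measureReal_restrict_apply (measurable_pi_apply i (measurableSet_singleton a))
  simp_rw [h2] at h
  rw [h]
  simp

lemma sum_measureReal_wordCyl_concat (μ : Measure (ℤ → A)) [IsFiniteMeasure μ] (j : ℤ)
    (v : List A) : ∑ a, μ.real (wordCyl j (v ++ [a])) = μ.real (wordCyl j v) := by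
  rw [← sum_measureReal_inter μ (j + v.length) (wordCyl j v)]
  refine Finset.sum_congr rfl fun a _ => ?_
  rw [wordCyl_append, Set.inter_comm]
  simp [wordCyl]

/-- The word at the sites `j, …, j + n - 1` of a configuration. -/
def readWord (j : ℤ) (n : ℕ) (x : ℤ → A) : List A := List.ofFn fun i : Fin n => x (j + i)

@[simp] lemma length_readWord (j : ℤ) (n : ℕ) (x : ℤ → A) : (readWord j n x).length = n := by
  simp [readWord]

lemma mem_wordCyl_iff_readWord (j : ℤ) (v : List A) (x : ℤ → A) :
    x ∈ wordCyl j v ↔ readWord j v.length x = v := by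
  rw [mem_wordCyl, List.ext_getElem_iff]
  simp [readWord]

/-- Sums over the patterns on an interval are sums over words. -/
lemma sum_cyl_eq_sum_wordCyl (n : ℕ) (g : Set (ℤ → A) → ℝ) :
    ∑ u : Finset.Icc (-(n : ℤ)) n → A, g (cyl _ u) =
      ∑ v ∈ wordSet A (2 * n + 1), g (wordCyl (-n) v) := by
  have hmem : ∀ i : Fin (2 * n + 1), -(n : ℤ) + i ∈ Finset.Icc (-(n : ℤ)) n := fun i => by
    rw [Finset.mem_Icc]; omega
  have hex : ∀ i ∈ Finset.Icc (-(n : ℤ)) n, ∃ k : ℕ, k < 2 * n + 1 ∧ i = -n + k := fun i hi => by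
    rw [Finset.mem_Icc] at hi
    exact ⟨(i + n).toNat, by omega, by omega⟩
  have hcyl : ∀ u : Finset.Icc (-(n : ℤ)) n → A, cyl _ u =
      wordCyl (-n) (List.ofFn fun i : Fin (2 * n + 1) => u ⟨_, hmem i⟩) := by
    intro u
    ext x
    rw [mem_wordCyl]
    constructor
    · intro h i hi
      rw [List.getElem_ofFn]
      exact h ⟨_, hmem ⟨i, by rwa [List.length_ofFn] at hi⟩⟩
    · rintro h ⟨i, hi⟩
      obtain ⟨k, hk, rfl⟩ := hex i hi
      have h2 := h k (by rwa [List.length_ofFn])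
      rwa [List.getElem_ofFn] at h2
  refine Finset.sum_bij (fun u _ => List.ofFn fun i : Fin (2 * n + 1) => u ⟨_, hmem i⟩)
    (fun u _ => by rw [mem_wordSet, List.length_ofFn]) (fun u _ u' _ h => ?_) (fun v hv => ?_)
    fun u _ => by rw [hcyl]
  · funext ⟨i, hi⟩
    obtain ⟨k, hk, rfl⟩ := hex i hi
    exact congrFun (List.ofFn_injective h) ⟨k, hk⟩
  · rw [mem_wordSet] at hv
    refine ⟨fun i => v[((i : ℤ) + n).toNat]'(by have := Finset.mem_Icc.mp i.2; omega),
      Finset.mem_univ _, ?_⟩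
    refine List.ext_getElem (by rw [List.length_ofFn, hv]) fun i h1 h2 => ?_
    rw [List.getElem_ofFn]
    simp

lemma cyl_Icc_eq_wordCyl (n : ℕ) (u : Finset.Icc (-(n : ℤ)) n → A) :
    ∃ v, cyl _ u = wordCyl (-n) v := by
  classical
  by_contra! h
  -- The identity of sums is tested on the indicator of the single set `cyl _ u`: the left side is
  -- at least one, while the right side would vanish.
  have h1 := sum_cyl_eq_sum_wordCyl n fun S => if S = cyl _ u then 1 else 0
  rw [Finset.sum_eq_zero fun v _ => if_neg (h v).symm] at h1
  have h2 : (1 : ℝ) ≤ ∑ u' : Finset.Icc (-(n : ℤ)) n → A,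
      (if cyl _ u' = cyl _ u then (1 : ℝ) else 0) := by
    refine le_trans ?_ (Finset.single_le_sum (fun u' _ => ?_) (Finset.mem_univ u))
    · simp
    · split_ifs <;> norm_num
  linarith

lemma ext_of_wordCyl {μ ν : Measure (ℤ → A)} [IsProbabilityMeasure μ] [IsProbabilityMeasure ν]
    (h : ∀ j v, μ.real (wordCyl j v) = ν.real (wordCyl j v)) : μ = ν := by
  have h1 : ∀ n : ℕ, μ.map (Finset.Icc (-(n : ℤ)) n).restrict =
      ν.map (Finset.Icc (-(n : ℤ)) n).restrict := by
    intro n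
    refine Measure.ext_of_singleton fun u => ?_
    rw [Measure.map_apply (measurable_restr _) (measurableSet_singleton u),
      Measure.map_apply (measurable_restr _) (measurableSet_singleton u), ← cyl_eq_preimage]
    obtain ⟨v, hv⟩ := cyl_Icc_eq_wordCyl n u
    rw [hv]
    exact (measureReal_eq_measureReal_iff).mp (h _ _)
  refine ext_of_generate_finite _ (generateFrom_measurableCylinders (α := fun _ : ℤ => A)).symm
    isPiSystem_measurableCylinders (fun s hs => ?_) (by simp)
  obtain ⟨I, S, hS, rfl⟩ := (mem_measurableCylinders _).mp hs
  obtain ⟨n, hn⟩ : ∃ n : ℕ, I ⊆ Finset.Icc (-(n : ℤ)) n := by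
    refine ⟨I.sup Int.natAbs, fun i hi => ?_⟩
    have := Finset.le_sup (f := Int.natAbs) hi
    rw [Finset.mem_Icc]
    omega
  have hS' : MeasurableSet (Finset.restrict₂ (π := fun _ : ℤ => A) hn ⁻¹' S) :=
    (measurable_pi_lambda _ fun i => measurable_pi_apply _) hS
  have h5 : cylinder (α := fun _ : ℤ => A) I S =
      (Finset.Icc (-(n : ℤ)) n).restrict ⁻¹' (Finset.restrict₂ (π := fun _ : ℤ => A) hn ⁻¹' S) := rfl
  rw [h5, ← Measure.map_apply (measurable_restr _) hS', h1 n,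
    Measure.map_apply (measurable_restr _) hS']

/-- The word measure of a shift-invariant measure. -/
def InvMeasure.onWords (μ : InvMeasure A) (v : List A) : ℝ := μ.meas.real (wordCyl 0 v)

lemma InvMeasure.real_wordCyl (μ : InvMeasure A) (j : ℤ) (v : List A) :
    μ.meas.real (wordCyl j v) = μ.onWords v := by
  have h : ∀ j, μ.meas.real (wordCyl (j + 1) v) = μ.meas.real (wordCyl j v) := by
    intro j
    rw [← shift_preimage_wordCyl, ← map_measureReal_apply measurable_shift
      (measurableSet_wordCyl j v), μ.shift_inv]
  induction j using Int.induction_on with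
  | zero => rfl
  | succ i ih => rw [h, ih]
  | pred i ih => rw [← h, sub_add_cancel, ih]

lemma InvMeasure.isWordMeasure_onWords (μ : InvMeasure A) : IsWordMeasure μ.onWords where
  nonneg v := measureReal_nonneg
  nil := by simp [onWords, wordCyl]
  sum_cons v := by
    rw [← μ.real_wordCyl (0 + 1) v, ← sum_measureReal_inter μ.meas 0]
    rfl
  sum_concat v := sum_measureReal_wordCyl_concat μ.meas 0 v

/-- The configuration that agrees with `x` on `-n, …, |x| - n - 1`. -/
def padWord (a : A) (n : ℕ) (x : List A) : ℤ → A := fun i => x.getD (i + n).toNat a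

open Classical in
lemma padWord_mem_wordCyl (a : A) (n : ℕ) (x v : List A) (j : ℤ) (hj : -n ≤ j)
    (hv : j + n + v.length ≤ x.length) :
    padWord a n x ∈ wordCyl j v ↔ v <+: x.drop (j + n).toNat := by
  rw [mem_wordCyl, List.prefix_iff_getElem]
  have h1 : ∀ i : ℕ, (j + i + n).toNat = (j + n).toNat + i := fun i => by omega
  constructor
  · refine fun h => ⟨by simp; omega, fun i hi => ?_⟩
    have := h i hi
    rw [padWord, h1, List.getD_eq_getElem _ _ (by omega)] at this
    simp [this]
  · rintro ⟨_, h⟩ i hi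
    have := h i hi
    rw [padWord, h1, List.getD_eq_getElem _ _ (by omega)]
    simp [this]

/-- A finite approximation of the measure with the word measure `M`. -/
def approxMeasure (M : List A → ℝ) (a : A) (n : ℕ) : Measure (ℤ → A) :=
  ∑ x ∈ wordSet A (2 * n + 1), ENNReal.ofReal (M x) • Measure.dirac (padWord a n x)

lemma isProbabilityMeasure_approxMeasure {M : List A → ℝ} (hM : IsWordMeasure M) (a : A) (n : ℕ) :
    IsProbabilityMeasure (approxMeasure M a n) := by
  constructor
  simp only [approxMeasure, Measure.finsetSum_apply, Measure.smul_apply, measure_univ, smul_eq_mul,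
    mul_one]
  rw [← ENNReal.ofReal_sum_of_nonneg fun x _ => hM.nonneg x, hM.sum_eq_one, ENNReal.ofReal_one]

/-- The value is exact as soon as the occurrence lies in the sites `-n, …, n`, where the padding
letter `a` plays no role. -/
lemma approxMeasure_wordCyl {M : List A → ℝ} (hM : IsWordMeasure M) (a : A) (n : ℕ) (j : ℤ)
    (v : List A) (hj : -n ≤ j) (hv : j + v.length ≤ n + 1) :
    approxMeasure M a n (wordCyl j v) = ENNReal.ofReal (M v) := by
  classical
  rw [← hM.sum_mul_occ (j + n).toNat v (2 * n + 1) (by omega),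
    ENNReal.ofReal_sum_of_nonneg fun x _ => mul_nonneg (hM.nonneg x) (occ_nonneg _ _ _)]
  simp only [approxMeasure, Measure.finsetSum_apply, Measure.smul_apply, smul_eq_mul]
  refine Finset.sum_congr rfl fun x hx => ?_
  rw [mem_wordSet] at hx
  rw [Measure.dirac_apply' _ (measurableSet_wordCyl j v), ENNReal.ofReal_mul (hM.nonneg x)]
  congr 1
  by_cases h : v <+: x.drop (j + n).toNat
  · rw [Set.indicator_of_mem ((padWord_mem_wordCyl a n x v j hj (by omega)).mpr h)]
    simp [occ, h]
  · rw [Set.indicator_of_notMem ((padWord_mem_wordCyl a n x v j hj (by omega)).not.mpr h)]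
    simp [occ, h]

/-- Every word measure comes from a shift-invariant probability measure. -/
theorem IsWordMeasure.exists_invMeasure {M : List A → ℝ} (hM : IsWordMeasure M) :
    ∃ μ : InvMeasure A, μ.onWords = M := by
  -- With the discrete topology on the finite alphabet, the configurations form a compact space, and
  -- so do the probability measures on it. A weak limit of the finite approximations is then
  -- available.
  let _ : TopologicalSpace A := ⊥
  have : DiscreteTopology A := ⟨rfl⟩
  have : BorelSpace A := ⟨by
    rw [borel_eq_top_of_discrete]
    exact eq_top_iff.mpr fun s _ => s.toFinite.measurableSet⟩
  obtain ⟨a⟩ : Nonempty A := by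
    by_contra h
    rw [not_nonempty_iff] at h
    have := hM.sum_cons []
    simp [hM.nil] at this
  let p : ℕ → ProbabilityMeasure (ℤ → A) := fun n =>
    ⟨approxMeasure M a n, isProbabilityMeasure_approxMeasure hM a n⟩
  obtain ⟨μ, -, hμ⟩ := isCompact_univ.ultrafilter_le_nhds ((hyperfilter ℕ).map p) (by simp)
  have hlim : Tendsto p (hyperfilter ℕ) (𝓝 μ) := hμ
  have hcyl : ∀ j v, (μ : Measure (ℤ → A)) (wordCyl j v) = ENNReal.ofReal (M v) := by
    intro j v
    -- Cylinders are clopen, so their masses converge under weak convergence; along the sequence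
    -- they are eventually constant.
    refine tendsto_nhds_unique
      (ProbabilityMeasure.tendsto_measure_of_null_frontier_of_tendsto' hlim
        (E := wordCyl j v) (by rw [(isClopen_wordCyl j v).frontier_eq]; simp)) ?_
    refine tendsto_const_nhds.congr' ?_
    refine hyperfilter_le_atTop (eventually_atTop.mpr
      ⟨j.natAbs + v.length, fun n hn => (approxMeasure_wordCyl hM a n j v ?_ ?_).symm⟩)
    · omega
    · omega
  have hreal : ∀ j v, (μ : Measure (ℤ → A)).real (wordCyl j v) = M v := fun j v => by
    rw [measureReal_def, hcyl, ENNReal.toReal_ofReal (hM.nonneg v)]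
  have : IsProbabilityMeasure ((μ : Measure (ℤ → A)).map shift) :=
    Measure.isProbabilityMeasure_map measurable_shift.aemeasurable
  refine ⟨⟨μ, inferInstance, ext_of_wordCyl fun j v => ?_⟩, funext fun v => hreal 0 v⟩
  rw [map_measureReal_apply measurable_shift (measurableSet_wordCyl j v), shift_preimage_wordCyl,
    hreal, hreal]

end WordCylinders

/-! ### The distance and the compactness of the space of shift-invariant measures -/

section Distance

open Filter Topology

variable {A : Type*} [MeasurableSpace A] [Fintype A] [MeasurableSingletonClass A]

/-- From `|a - b| = a + b - 2 min a b` and total masses one. Lower bounds on masses of words thus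
become upper bounds on distances. -/
lemma tvOn_Icc (n : ℕ) (μ ν : InvMeasure A) :
    tvOn (Finset.Icc (-(n : ℤ)) n) μ ν =
      1 - ∑ v ∈ wordSet A (2 * n + 1), min (μ.onWords v) (ν.onWords v) := by
  rw [tvOn, sum_cyl_eq_sum_wordCyl n fun S => |μ.meas.real S - ν.meas.real S|]
  simp_rw [InvMeasure.real_wordCyl]
  have h : ∀ a b : ℝ, |a - b| = a + b - 2 * min a b := fun a b => by
    rcases le_total a b with h | h
    · rw [abs_of_nonpos (by linarith), min_eq_left h]; ring
    · rw [abs_of_nonneg (by linarith), min_eq_right h]; ring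
  simp_rw [h]
  rw [Finset.sum_sub_distrib, Finset.sum_add_distrib, μ.isWordMeasure_onWords.sum_eq_one,
    ν.isWordMeasure_onWords.sum_eq_one, ← Finset.mul_sum]
  ring

lemma dist_eq_tsum (μ ν : InvMeasure A) :
    dist μ ν = ∑' n : ℕ, (1 / 2 : ℝ) ^ n * tvOn (Finset.Icc (-(n : ℤ)) n) μ ν := rfl

lemma sum_tvOn_Icc (n : ℕ) (μ ν : InvMeasure A) :
    ∑ m ∈ Finset.range (n + 1), (1 / 2 : ℝ) ^ m * tvOn (Finset.Icc (-(m : ℤ)) m) μ ν =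
      ∑ m ∈ Finset.range (n + 1), (1 / 2 : ℝ) ^ m - overlap n μ.onWords ν.onWords := by
  simp_rw [tvOn_Icc, mul_sub, mul_one, Finset.sum_sub_distrib, overlap]

/-- The weights `2⁻ⁿ` sum to `2`, and each neglected total variation is at most one. -/
lemma dist_le_sub_overlap (n : ℕ) (μ ν : InvMeasure A) :
    dist μ ν ≤ 2 - overlap n μ.onWords ν.onWords := by
  have h1 := (summable_dM μ ν).sum_add_tsum_nat_add (n + 1)
  have h2 := summable_geometric_two.sum_add_tsum_nat_add (n + 1)
  rw [tsum_geometric_two] at h2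
  rw [sum_tvOn_Icc] at h1
  have h3 := ((summable_nat_add_iff (n + 1)).mpr (summable_dM μ ν)).tsum_le_tsum
    (fun m => mul_le_of_le_one_right (by positivity) (tvOn_le_one _ _ _))
    ((summable_nat_add_iff (n + 1)).mpr summable_geometric_two)
  rw [dist_eq_tsum]
  linarith

/-- The partial sums of the distance are the partial geometric sums minus the overlaps, and the
former tend to `2`. -/
lemma le_dist_of_overlap_le {μ ν : InvMeasure A} {s : ℝ}
    (h : ∀ n, overlap n μ.onWords ν.onWords ≤ 2 - s) : s ≤ dist μ ν := by
  have h1 : ∀ n, (∑ m ∈ Finset.range (n + 1), (1 / 2 : ℝ) ^ m) - 2 + s ≤ dist μ ν := by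
    intro n
    have h2 := (summable_dM μ ν).sum_le_tsum (Finset.range (n + 1)) fun m _ =>
      mul_nonneg (by positivity) (tvOn_nonneg _ _ _)
    rw [sum_tvOn_Icc] at h2
    rw [dist_eq_tsum]
    linarith [h n]
  have h3 : Tendsto (fun n => (∑ m ∈ Finset.range (n + 1), (1 / 2 : ℝ) ^ m) - 2 + s) atTop
      (𝓝 (2 - 2 + s)) :=
    (((hasSum_geometric_two.tendsto_sum_nat).comp (tendsto_add_atTop_nat 1)).sub_const 2).add_const s
  simpa using le_of_tendsto' h3 h1

/-- Every sequence of shift-invariant measures converges along an ultrafilter. -/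
lemma exists_tendsto_invMeasure (p : ℕ → InvMeasure A) :
    ∃ μ, Tendsto p (hyperfilter ℕ) (𝓝 μ) := by
  obtain ⟨M, hM⟩ := exists_tendsto_hyperfilter (fun n => (p n).onWords)
    (fun n v => (p n).isWordMeasure_onWords.nonneg v)
    fun n v => (p n).isWordMeasure_onWords.le_one v
  obtain ⟨μ, rfl⟩ := (IsWordMeasure.of_tendsto hM
    (fun n v => (p n).isWordMeasure_onWords.nonneg v)
    (fun n => (p n).isWordMeasure_onWords.nil)
    (fun v => by simp [(p _).isWordMeasure_onWords.sum_cons])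
    (fun v => by simp [(p _).isWordMeasure_onWords.sum_concat])).exists_invMeasure
  refine ⟨μ, tendsto_iff_dist_tendsto_zero.mpr ?_⟩
  have hv : ∀ v, Tendsto (fun n => (p n).onWords v) (hyperfilter ℕ) (𝓝 (μ.onWords v)) :=
    tendsto_pi_nhds.mp hM
  have h0 : (0 : ℝ) = ∑' n : ℕ, (1 / 2 : ℝ) ^ n * tvOn (Finset.Icc (-(n : ℤ)) n) μ μ := by
    rw [← dist_eq_tsum, dist_self]
  simp_rw [dist_eq_tsum]
  rw [h0]
  -- Convergence on each word suffices: each level is a finite sum, and the levels are dominated by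
  -- `2⁻ⁿ`.
  refine tendsto_tsum_of_dominated_convergence summable_geometric_two (fun m => ?_)
    (Eventually.of_forall fun n m => ?_)
  · simp_rw [tvOn_Icc]
    exact (tendsto_const_nhds.sub (tendsto_finsetSum _ fun v _ =>
      (hv v).min tendsto_const_nhds)).const_mul _
  · rw [Real.norm_of_nonneg (mul_nonneg (by positivity) (tvOn_nonneg _ _ _))]
    exact mul_le_of_le_one_right (by positivity) (tvOn_le_one _ _ _)

end Distance

/-! ### Invariant measures and invariant word measures -/

section Invariance

open Filter Topology

variable {A : Type*}

/-- The product form is what the product law of the automaton yields, and it is also convenient for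
primitive recursion. The default `a` is never read, since `i < v.length`. -/
lemma transition_eq_prod (ρ : List A → A → ℝ) (a : A) (x v : List A) :
    transition ρ x v = ∏ i ∈ Finset.range v.length, ρ (x.drop i) (v.getD i a) := by
  induction v generalizing x with
  | nil => simp [transition]
  | cons b v ih =>
    rw [transition, ih, List.length_cons, Finset.prod_range_succ', mul_comm]
    simp

lemma infinitePi_wordCyl [MeasurableSpace A] [MeasurableSingletonClass A] (m : ℤ → Measure A)
    [∀ i, IsProbabilityMeasure (m i)] (a : A) (j : ℤ) (v : List A) :
    Measure.infinitePi m (wordCyl j v) = ∏ i ∈ Finset.range v.length, m (j + i) {v.getD i a} := by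
  classical
  have h1 : wordCyl j v = Set.pi ((Finset.range v.length).image fun i : ℕ => j + i)
      fun i => {v.getD (i - j).toNat a} := by
    ext x
    rw [mem_wordCyl]
    simp only [Set.mem_pi, Finset.coe_image, Set.mem_image, Finset.coe_range, Set.mem_Iio,
      Set.mem_singleton_iff, forall_exists_index, and_imp, forall_apply_eq_imp_iff₂]
    refine forall₂_congr fun i hi => ?_
    rw [add_sub_cancel_left, Int.toNat_natCast, List.getD_eq_getElem _ _ hi]
  rw [h1, Measure.infinitePi_pi _ fun i _ => measurableSet_singleton _,
    Finset.prod_image fun i _ i' _ h => by simpa using h]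
  simp

variable [Fintype A] {N : Finset ℤ}

/-- The entries of `φ` as a rule on words, reading the first `2 r + 1` letters. -/
def wordRule (r : ℕ) (a : A) (φ : StochRule A N) (z : List A) (b : A) : ℝ :=
  φ.entry (fun j => z.getD ((j : ℤ) + r).toNat a) b

lemma isLocalRule_wordRule (r : ℕ) (hN : ∀ j ∈ N, j.natAbs ≤ r) (a : A) (φ : StochRule A N) :
    IsLocalRule r (wordRule r a φ) where
  nonneg z b := (φ.entry _ b).2.1
  sum_eq_one z := φ.sum_entry _
  take z b := by
    unfold wordRule
    congr 3
    funext j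
    have := hN j j.2
    rw [List.getD_eq_getElem?_getD, List.getD_eq_getElem?_getD, List.getElem?_take_of_lt (by omega)]

variable [MeasurableSpace A] [MeasurableSingletonClass A]

lemma siteLaw_singleton (φ : StochRule A N) (u : N → A) (b : A) :
    siteLaw φ u {b} = ENNReal.ofReal (φ.entry u b) := by
  classical
  simp only [siteLaw, Measure.finsetSum_apply, Measure.smul_apply, smul_eq_mul]
  rw [Finset.sum_eq_single b]
  · simp
  · intro c _ hc
    simp [hc]
  · simp

/-- The word is read from site `j - r`, so dropping `i` letters puts the neighbour `n` of site `j +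
i` at index `n + r`. As `|n| ≤ r`, this index stays inside the word and the default letter is not
used. -/
lemma pcaKernel_wordCyl (r : ℕ) (hN : ∀ j ∈ N, j.natAbs ≤ r) (a : A) (φ : StochRule A N)
    (x : ℤ → A) (j : ℤ) (v : List A) :
    pcaKernel φ x (wordCyl j v) = ENNReal.ofReal
      (transition (wordRule r a φ) (readWord (j - r) (v.length + 2 * r) x) v) := by
  rw [transition_eq_prod _ a, ENNReal.ofReal_prod_of_nonneg fun i _ =>
    (isLocalRule_wordRule r hN a φ).nonneg _ _]
  refine (infinitePi_wordCyl (fun i => siteLaw φ (window N x i)) a j v).trans ?_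
  refine Finset.prod_congr rfl fun i hi => ?_
  rw [Finset.mem_range] at hi
  rw [siteLaw_singleton, wordRule]
  congr 4
  funext n
  have := hN n n.2
  rw [List.getD_eq_getElem _ _ (by simp; omega)]
  simp only [window, readWord, List.getElem_drop, List.getElem_ofFn]
  congr 1
  push_cast
  omega

lemma real_bind_wordCyl (r : ℕ) (hN : ∀ j ∈ N, j.natAbs ≤ r) (a : A) (φ : StochRule A N)
    (μ : InvMeasure A) (j : ℤ) (v : List A) :
    (μ.meas.bind (pcaKernel φ)).real (wordCyl j v) =
      ∑ z ∈ wordSet A (v.length + 2 * r), μ.onWords z * transition (wordRule r a φ) z v := by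
  classical
  have hnn : ∀ z, 0 ≤ transition (wordRule r a φ) z v :=
    fun z => transition_nonneg (isLocalRule_wordRule r hN a φ).nonneg z v
  rw [measureReal_def, Measure.bind_apply (measurableSet_wordCyl j v)
    (pcaKernel φ).measurable.aemeasurable]
  have h1 : ∀ x, pcaKernel φ x (wordCyl j v) = ∑ z ∈ wordSet A (v.length + 2 * r),
      (wordCyl (j - r) z).indicator
        (fun _ => ENNReal.ofReal (transition (wordRule r a φ) z v)) x := by
    intro x
    rw [pcaKernel_wordCyl r hN a, Finset.sum_eq_single (readWord (j - r) (v.length + 2 * r) x)]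
    · rw [Set.indicator_of_mem]
      rw [mem_wordCyl_iff_readWord, length_readWord]
    · intro z hz hne
      rw [mem_wordSet] at hz
      refine Set.indicator_of_notMem (fun h => hne ?_) _
      rw [mem_wordCyl_iff_readWord, hz] at h
      exact h.symm
    · simp
  simp_rw [h1]
  rw [lintegral_finsetSum _ fun z _ => measurable_const.indicator (measurableSet_wordCyl _ z),
    ENNReal.toReal_sum]
  · refine Finset.sum_congr rfl fun z _ => ?_
    rw [lintegral_indicator_const (measurableSet_wordCyl _ z), ENNReal.toReal_mul,
      ENNReal.toReal_ofReal (hnn z), ← measureReal_def, μ.real_wordCyl, mul_comm]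
  · intro z _
    rw [lintegral_indicator_const (measurableSet_wordCyl _ z)]
    exact ENNReal.mul_ne_top ENNReal.ofReal_ne_top (measure_ne_top _ _)

instance (φ : StochRule A N) : IsMarkovKernel (pcaKernel φ) :=
  ⟨fun x => inferInstanceAs
    (IsProbabilityMeasure (Measure.infinitePi fun i => siteLaw φ (window N x i)))⟩

lemma mem_invariantMeasures_iff (r : ℕ) (hN : ∀ j ∈ N, j.natAbs ≤ r) (a : A) (φ : StochRule A N)
    (μ : InvMeasure A) :
    μ ∈ invariantMeasures φ ↔ WordInvariant r (wordRule r a φ) μ.onWords := by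
  constructor
  · intro h v
    rw [← real_bind_wordCyl r hN a φ μ 0 v, show μ.meas.bind (pcaKernel φ) = μ.meas from h]
    rfl
  · intro h
    refine ext_of_wordCyl fun j v => ?_
    rw [real_bind_wordCyl r hN a, h v, μ.real_wordCyl]

lemma exists_natAbs_le (N : Finset ℤ) : ∃ r : ℕ, ∀ j ∈ N, j.natAbs ≤ r :=
  ⟨N.sup Int.natAbs, fun _ hj => Finset.le_sup (f := Int.natAbs) hj⟩

/-- The Krylov–Bogolyubov argument: a limit of empirical averages from constant words is invariant.
-/
lemma nonempty_invariantMeasures [Nonempty A] (φ : StochRule A N) :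
    (invariantMeasures φ).Nonempty := by
  obtain ⟨r, hN⟩ := exists_natAbs_le N
  obtain ⟨a⟩ := ‹Nonempty A›
  obtain ⟨M, hM, hinv, -⟩ := (isLocalRule_wordRule r hN a φ).exists_limit
    (fun T => List.replicate (blockLength r T) a) (by simp)
  obtain ⟨μ, rfl⟩ := hM.exists_invMeasure
  exact ⟨μ, (mem_invariantMeasures_iff r hN a φ μ).mpr hinv⟩

end Invariance

/-! ### Zero-noise limits -/

section ZeroNoise

open Filter Topology

lemma isClosed_acc {X : Type*} [MetricSpace X] (M : Set.Ioi (0 : ℝ) → Set X) :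
    IsClosed (acc M) := by
  refine isClosed_of_closure_subset fun μ hμ δ hδ ε₀ hε₀ => ?_
  obtain ⟨μ', hμ', hd⟩ := Metric.mem_closure_iff.mp hμ (δ / 2) (by positivity)
  obtain ⟨ε, hε, ν, hν, hd'⟩ := hμ' (δ / 2) (by positivity) ε₀ hε₀
  exact ⟨ε, hε, ν, hν, (dist_triangle _ _ _).trans_lt (by linarith)⟩

variable {A : Type*} [Fintype A] [MeasurableSpace A] [MeasurableSingletonClass A] {N : Finset ℤ}

/-- If every `ε < ε₀` had an invariant measure at distance at least `s + δ`, a family made of these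
would stay away from the zero-noise limit in the ball, contrary to uniform approach. -/
lemma exists_invariantMeasures_subset_ball [Nonempty A] {φ : Set.Ioi (0 : ℝ) → StochRule A N}
    (hunif : UniformlyApproached φ) {p : InvMeasure A} {s : ℝ}
    (h : (zeroNoiseLimits φ ∩ Metric.closedBall p s).Nonempty) {ε₀ δ : ℝ} (hε₀ : 0 < ε₀)
    (hδ : 0 < δ) :
    ∃ ε : Set.Ioi (0 : ℝ), (ε : ℝ) < ε₀ ∧ ∀ μ ∈ invariantMeasures (φ ε), dist μ p < s + δ := by
  by_contra! hc
  have : ∀ ε : Set.Ioi (0 : ℝ), ∃ μ ∈ invariantMeasures (φ ε), (ε : ℝ) < ε₀ → s + δ ≤ dist μ p := by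
    intro ε
    by_cases hε : (ε : ℝ) < ε₀
    · obtain ⟨μ, h1, h2⟩ := hc ε hε
      exact ⟨μ, h1, fun _ => h2⟩
    -- The family must be defined for all `ε > 0`; away from zero any invariant measure will do.
    · obtain ⟨μ, hμ⟩ := nonempty_invariantMeasures (φ ε)
      exact ⟨μ, hμ, fun h => absurd h hε⟩
  choose π hπ hd using this
  obtain ⟨μ, hμ, hμp⟩ := h
  rw [hunif π hπ] at hμ
  obtain ⟨ε, hε, ν, rfl, hν⟩ := hμ δ hδ ε₀ hε₀
  have h1 := hd ε hε
  have h2 := dist_triangle_left (π ε) p μ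
  rw [Metric.mem_closedBall] at hμp
  linarith

/-- One invariant measure is picked for each `n`; by compactness they have a limit, which is a
zero-noise limit and lies in the ball. -/
lemma zeroNoiseLimits_inter_closedBall_nonempty [Nonempty A]
    {φ : Set.Ioi (0 : ℝ) → StochRule A N} {p : InvMeasure A} {s : ℝ}
    (h : ∀ n : ℕ, ∃ ε : Set.Ioi (0 : ℝ), (ε : ℝ) < 1 / ((n : ℝ) + 1) ∧
      ∀ μ ∈ invariantMeasures (φ ε), dist μ p ≤ s + 1 / ((n : ℝ) + 1)) :
    (zeroNoiseLimits φ ∩ Metric.closedBall p s).Nonempty := by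
  choose ε hε hd using h
  choose π hπ using fun n => nonempty_invariantMeasures (φ (ε n))
  obtain ⟨μ, hμ⟩ := exists_tendsto_invMeasure π
  have h0 : Tendsto (fun n : ℕ => 1 / ((n : ℝ) + 1)) (hyperfilter ℕ) (𝓝 0) :=
    tendsto_one_div_add_atTop_nhds_zero_nat.mono_left hyperfilter_le_atTop
  refine ⟨μ, fun δ hδ ε₀ hε₀ => ?_, ?_⟩
  · obtain ⟨n, h1, h2⟩ := ((h0.eventually_lt_const hε₀).and
      (hμ.eventually (Metric.ball_mem_nhds μ hδ))).exists
    exact ⟨ε n, (hε n).trans h1, π n, hπ n, by rwa [dist_comm]⟩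
  · have h3 := le_of_tendsto_of_tendsto' (hμ.dist tendsto_const_nhds) (h0.const_add s)
      fun n => hd n (π n) (hπ n)
    simpa using h3

end ZeroNoise

/-! ### Primitive recursive functions with non-negative rational values -/

section PrimrecReal

open Primrec

variable {α β : Type*} [Primcodable α] [Primcodable β]

/-- The non-negative rational number `p / (d + 1)` coded by `(p, d)`. -/
def fracVal (c : ℕ × ℕ) : ℝ := (c.1 : ℝ) / (c.2 + 1)

lemma fracVal_nonneg (c : ℕ × ℕ) : 0 ≤ fracVal c := by unfold fracVal; positivity

/-- A real function whose values are given by primitive recursive fractions. -/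
def PrimrecReal (g : α → ℝ) : Prop := ∃ c : α → ℕ × ℕ, Primrec c ∧ ∀ a, g a = fracVal (c a)

namespace PrimrecReal

lemma of_eq {g h : α → ℝ} (hg : PrimrecReal g) (e : ∀ a, g a = h a) : PrimrecReal h :=
  (funext e : g = h) ▸ hg

lemma comp {g : β → ℝ} {f : α → β} (hg : PrimrecReal g) (hf : Primrec f) :
    PrimrecReal fun a => g (f a) := by
  obtain ⟨c, hc, h⟩ := hg
  exact ⟨fun a => c (f a), hc.comp hf, fun a => h _⟩

lemma fracVal_comp {c : α → ℕ × ℕ} (hc : Primrec c) : PrimrecReal fun a => fracVal (c a) :=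
  ⟨c, hc, fun _ => rfl⟩

lemma natCast {f : α → ℕ} (hf : Primrec f) : PrimrecReal fun a => (f a : ℝ) :=
  ⟨fun a => (f a, 0), Primrec.pair hf (Primrec.const 0), fun a => by simp [fracVal]⟩

lemma const_nat (n : ℕ) : PrimrecReal fun _ : α => (n : ℝ) := natCast (Primrec.const n)

lemma one_div_succ {f : α → ℕ} (hf : Primrec f) : PrimrecReal fun a => 1 / ((f a : ℝ) + 1) :=
  ⟨fun a => (1, f a), Primrec.pair (Primrec.const 1) hf, fun a => by simp [fracVal]⟩

lemma one_half_pow {f : α → ℕ} (hf : Primrec f) : PrimrecReal fun a => (1 / 2 : ℝ) ^ f a := by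
  have h : Primrec fun a => (fun n => 2 * n)^[f a] 1 :=
    Primrec.nat_iterate hf (Primrec.const 1)
      (Primrec.nat_mul.comp (Primrec.const 2) Primrec.snd)
  have h2 : ∀ m : ℕ, (fun n => 2 * n)^[m] 1 = 2 ^ m := fun m => by
    induction m with
    | zero => rfl
    | succ m ih => rw [Function.iterate_succ_apply', ih, pow_succ, mul_comm]
  -- A code stores the denominator minus one.
  refine ⟨fun a => (1, (fun n => 2 * n)^[f a] 1 - 1), Primrec.pair (Primrec.const 1)
    (Primrec.nat_sub.comp h (Primrec.const 1)), fun a => ?_⟩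
  simp only [h2, fracVal]
  rw [Nat.cast_sub Nat.one_le_two_pow]
  simp

lemma mul {g h : α → ℝ} (hg : PrimrecReal g) (hh : PrimrecReal h) :
    PrimrecReal fun a => g a * h a := by
  obtain ⟨c, hc, hg⟩ := hg
  obtain ⟨d, hd, hh⟩ := hh
  -- The second component is `(c + 1)(d + 1) - 1`, expanded to avoid subtraction.
  refine ⟨fun a => ((c a).1 * (d a).1, (c a).2 * (d a).2 + (c a).2 + (d a).2), ?_, fun a => ?_⟩
  · exact Primrec.pair (Primrec.nat_mul.comp (fst.comp hc) (fst.comp hd))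
      (Primrec.nat_add.comp (Primrec.nat_add.comp
        (Primrec.nat_mul.comp (snd.comp hc) (snd.comp hd)) (snd.comp hc)) (snd.comp hd))
  · simp only [hg, hh, fracVal]
    push_cast
    rw [div_mul_div_comm]
    congr 1
    ring

lemma add {g h : α → ℝ} (hg : PrimrecReal g) (hh : PrimrecReal h) :
    PrimrecReal fun a => g a + h a := by
  obtain ⟨c, hc, hg⟩ := hg
  obtain ⟨d, hd, hh⟩ := hh
  refine ⟨fun a => ((c a).1 * ((d a).2 + 1) + (d a).1 * ((c a).2 + 1),
    (c a).2 * (d a).2 + (c a).2 + (d a).2), ?_, fun a => ?_⟩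
  · exact Primrec.pair
      (Primrec.nat_add.comp
        (Primrec.nat_mul.comp (fst.comp hc) (Primrec.succ.comp (snd.comp hd)))
        (Primrec.nat_mul.comp (fst.comp hd) (Primrec.succ.comp (snd.comp hc))))
      (Primrec.nat_add.comp (Primrec.nat_add.comp
        (Primrec.nat_mul.comp (snd.comp hc) (snd.comp hd)) (snd.comp hc)) (snd.comp hd))
  · simp only [hg, hh, fracVal]
    push_cast
    rw [div_add_div _ _ (by positivity) (by positivity)]
    congr 1 <;> ring

lemma le {g h : α → ℝ} (hg : PrimrecReal g) (hh : PrimrecReal h) :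
    PrimrecPred fun a => g a ≤ h a := by
  obtain ⟨c, hc, hg⟩ := hg
  obtain ⟨d, hd, hh⟩ := hh
  refine (Primrec.nat_le.comp
    (Primrec.nat_mul.comp (fst.comp hc) (Primrec.succ.comp (snd.comp hd)))
    (Primrec.nat_mul.comp (fst.comp hd) (Primrec.succ.comp (snd.comp hc)))).of_eq fun a => ?_
  rw [hg, hh]
  unfold fracVal
  rw [div_le_div_iff₀ (by positivity) (by positivity)]
  exact_mod_cast Iff.rfl

lemma lt {g h : α → ℝ} (hg : PrimrecReal g) (hh : PrimrecReal h) :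
    PrimrecPred fun a => g a < h a :=
  (hh.le hg).not.of_eq fun _ => not_le

lemma ite {p : α → Prop} [DecidablePred p] {g h : α → ℝ} (hp : PrimrecPred p)
    (hg : PrimrecReal g) (hh : PrimrecReal h) : PrimrecReal fun a => if p a then g a else h a := by
  obtain ⟨c, hc, hg⟩ := hg
  obtain ⟨d, hd, hh⟩ := hh
  refine ⟨fun a => if p a then c a else d a, Primrec.ite hp hc hd, fun a => ?_⟩
  dsimp only
  split_ifs
  · exact hg a
  · exact hh a

lemma min {g h : α → ℝ} (hg : PrimrecReal g) (hh : PrimrecReal h) :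
    PrimrecReal fun a => min (g a) (h a) := by
  classical
  exact (ite (hg.le hh) hg hh).of_eq fun a => (min_def _ _).symm

/-- The fold is carried out on codes of fractions, which are data, rather than on real numbers. -/
lemma list_foldr {f : α → List β} {g : α → β → ℝ} (op : ℝ → ℝ → ℝ) (e : ℕ)
    (hop : PrimrecReal fun p : (ℕ × ℕ) × (ℕ × ℕ) => op (fracVal p.1) (fracVal p.2))
    (hf : Primrec f) (hg : PrimrecReal fun p : α × β => g p.1 p.2) :
    PrimrecReal fun a => ((f a).map (g a)).foldr op e := by
  obtain ⟨c, hc, hg⟩ := hg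
  obtain ⟨o, ho, hoe⟩ := hop
  have h1 : Primrec fun a => (f a).foldr (fun b s => o (c (a, b), s)) (e, 0) :=
    Primrec.list_foldr hf (Primrec.const (e, 0))
      (ho.comp (Primrec.pair (hc.comp (Primrec.pair fst (fst.comp snd))) (snd.comp snd))).to₂
  refine ⟨_, h1, fun a => ?_⟩
  dsimp only
  induction f a with
  | nil => simp [fracVal]
  | cons b l ih =>
    rw [List.map_cons, List.foldr_cons, List.foldr_cons, ih, ← hoe]
    simp only [← hg (a, b)]

lemma list_sum {f : α → List β} {g : α → β → ℝ} (hf : Primrec f)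
    (hg : PrimrecReal fun p : α × β => g p.1 p.2) :
    PrimrecReal fun a => ((f a).map (g a)).sum :=
  (list_foldr (· + ·) 0 ((fracVal_comp fst).add (fracVal_comp snd)) hf hg).of_eq fun a => by
    rw [List.sum_eq_foldr, Nat.cast_zero]

lemma list_prod {f : α → List β} {g : α → β → ℝ} (hf : Primrec f)
    (hg : PrimrecReal fun p : α × β => g p.1 p.2) :
    PrimrecReal fun a => ((f a).map (g a)).prod :=
  (list_foldr (· * ·) 1 ((fracVal_comp fst).mul (fracVal_comp snd)) hf hg).of_eq fun a => by
    rw [List.prod_eq_foldr, Nat.cast_one]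

lemma sum_range {f : α → ℕ} {g : α → ℕ → ℝ} (hf : Primrec f)
    (hg : PrimrecReal fun p : α × ℕ => g p.1 p.2) :
    PrimrecReal fun a => ∑ i ∈ Finset.range (f a), g a i :=
  (list_sum (Primrec.list_range.comp hf) hg).of_eq fun _ => rfl

lemma prod_range {f : α → ℕ} {g : α → ℕ → ℝ} (hf : Primrec f)
    (hg : PrimrecReal fun p : α × ℕ => g p.1 p.2) :
    PrimrecReal fun a => ∏ i ∈ Finset.range (f a), g a i :=
  (list_prod (Primrec.list_range.comp hf) hg).of_eq fun _ => rfl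

end PrimrecReal

end PrimrecReal

/-! ### Primitive recursiveness of the empirical averages -/

section PrimrecWords

set_option linter.unusedSectionVars false

open Primrec

variable {A : Type*} [Fintype A]

lemma sum_map_flatMap {β γ : Type*} (l : List β) (f : β → List γ) (g : γ → ℝ) :
    ((l.flatMap f).map g).sum = (l.map fun b => ((f b).map g).sum).sum := by
  induction l with
  | nil => rfl
  | cons b l ih => simp [ih]

/-- The list of all words of length `n`. -/
def wordList (A : Type*) [Fintype A] (n : ℕ) : List (List A) :=
  (fun l => (Finset.univ : Finset A).toList.flatMap fun a => l.map (a :: ·))^[n] [[]]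

lemma sum_map_wordList (n : ℕ) (h : List A → ℝ) :
    ((wordList A n).map h).sum = ∑ v ∈ wordSet A n, h v := by
  induction n generalizing h with
  | zero => simp [wordList]
  | succ n ih =>
    rw [wordList, Function.iterate_succ_apply', sum_wordSet_succ, sum_map_flatMap,
      Finset.sum_map_toList]
    refine Finset.sum_congr rfl fun a _ => ?_
    rw [← ih, List.map_map]
    rfl

lemma mem_wordList {n : ℕ} {v : List A} : v ∈ wordList A n ↔ v.length = n := by
  induction n generalizing v with
  | zero => simp [wordList]
  | succ n ih =>
    rw [wordList, Function.iterate_succ_apply']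
    change v ∈ List.flatMap (fun a => (wordList A n).map (a :: ·)) _ ↔ _
    cases v <;> simp [ih]

/-- The rule on words given by a finite table. -/
def tableRule (r : ℕ) (tab : List ((List A × A) × ℕ × ℕ)) (z : List A) (b : A) : ℝ :=
  open Classical in
  (tab.map fun e => if e.1 = (z.take (2 * r + 1), b) then fracVal e.2 else 0).sum

lemma tableRule_nonneg (r : ℕ) (tab : List ((List A × A) × ℕ × ℕ)) (z : List A) (b : A) :
    0 ≤ tableRule r tab z b := by
  refine List.sum_nonneg fun x hx => ?_
  obtain ⟨e, -, rfl⟩ := List.mem_map.mp hx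
  split_ifs
  exacts [fracVal_nonneg _, le_rfl]

variable [Primcodable A] {α : Type*} [Primcodable α]

lemma primrec_wordList : Primrec (wordList A) := by
  refine Primrec.nat_iterate Primrec.id (Primrec.const [[]]) ?_
  refine Primrec.list_flatMap (Primrec.const _) ?_
  refine Primrec.list_map (snd.comp fst) ?_
  exact Primrec.list_cons.comp (snd.comp fst) snd

lemma PrimrecReal.sum_wordSet {f : α → ℕ} {g : α → List A → ℝ} (hf : Primrec f)
    (hg : PrimrecReal fun p : α × List A => g p.1 p.2) :
    PrimrecReal fun a => ∑ v ∈ wordSet A (f a), g a v :=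
  (list_sum (primrec_wordList.comp hf) hg).of_eq fun a => sum_map_wordList (f a) (g a)

lemma primrecReal_tableRule (r : ℕ) :
    PrimrecReal fun p : List ((List A × A) × ℕ × ℕ) × List A × A =>
      tableRule r p.1 p.2.1 p.2.2 := by
  classical
  have h1 : PrimrecPred fun p : (List ((List A × A) × ℕ × ℕ) × List A × A) ×
      ((List A × A) × ℕ × ℕ) => p.2.1 = (p.1.2.1.take (2 * r + 1), p.1.2.2) :=
    Primrec.eq.comp (fst.comp snd) (Primrec.pair
      (Primrec.list_take.comp (Primrec.const _) (fst.comp (snd.comp fst)))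
      (snd.comp (snd.comp fst)))
  refine (PrimrecReal.list_sum (g := fun p e =>
    if e.1 = (p.2.1.take (2 * r + 1), p.2.2) then fracVal e.2 else (0 : ℕ)) fst (PrimrecReal.ite h1
    (PrimrecReal.fracVal_comp (snd.comp snd)) (PrimrecReal.const_nat 0))).of_eq fun p => ?_
  rw [tableRule]
  congr 2
  funext e
  simp

lemma primrecReal_transition (r : ℕ) (a : A) :
    PrimrecReal fun p : List ((List A × A) × ℕ × ℕ) × List A × List A =>
      transition (tableRule r p.1) p.2.1 p.2.2 := by
  simp_rw [transition_eq_prod _ a]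
  refine PrimrecReal.prod_range (Primrec.list_length.comp (snd.comp snd)) ?_
  exact (primrecReal_tableRule r).comp (Primrec.pair (fst.comp fst) (Primrec.pair
    (Primrec.list_drop.comp snd (fst.comp (snd.comp fst)))
    ((Primrec.list_getD a).comp (snd.comp (snd.comp fst)) snd)))

/-- `markov` iterates on functions, which are not data for primitive recursion. The adjoint
evolution is used instead: a finite list of weighted words is pushed forward `t` times and paired
with `h` only at the end. -/
lemma primrecReal_iterate_markov (r : ℕ) (a : A) {f : α → List ((List A × A) × ℕ × ℕ)}
    {t : α → ℕ} {x : α → List A} {h : α → List A → ℝ} (hf : Primrec f) (ht : Primrec t)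
    (hx : Primrec x) (hh : PrimrecReal fun p : α × List A => h p.1 p.2) :
    PrimrecReal fun s => (markov r (tableRule r (f s)))^[t s] (h s) (x s) := by
  obtain ⟨c, hc, hcv⟩ := primrecReal_transition r a
  obtain ⟨m, hm, hmv⟩ := (PrimrecReal.fracVal_comp (α := (ℕ × ℕ) × (ℕ × ℕ)) fst).mul
    (PrimrecReal.fracVal_comp (α := (ℕ × ℕ) × (ℕ × ℕ)) snd)
  let step : List ((List A × A) × ℕ × ℕ) → List ((ℕ × ℕ) × List A) → List ((ℕ × ℕ) × List A) :=
    fun tab l => l.flatMap fun e =>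
      (wordList A (e.2.length - 2 * r)).map fun y => (m (e.1, c (tab, e.2, y)), y)
  have hstep : Primrec₂ step := by
    refine Primrec.list_flatMap snd ?_
    refine Primrec.list_map (primrec_wordList.comp (Primrec.nat_sub.comp
      (Primrec.list_length.comp (snd.comp snd)) (Primrec.const _))) ?_
    exact Primrec.pair (hm.comp (Primrec.pair (fst.comp (snd.comp fst))
      (hc.comp (Primrec.pair (fst.comp (fst.comp fst))
        (Primrec.pair (snd.comp (snd.comp fst)) snd))))) snd
  -- Pushing the weighted list forward is adjoint to applying `markov`.
  have hsum : ∀ tab t (g : List A → ℝ) l,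
      (((step tab)^[t] l).map fun e => fracVal e.1 * g e.2).sum =
        (l.map fun e => fracVal e.1 * (markov r (tableRule r tab))^[t] g e.2).sum := by
    intro tab t g l
    induction t generalizing l with
    | zero => rfl
    | succ t ih =>
      rw [Function.iterate_succ_apply, ih]
      simp only [step, sum_map_flatMap]
      congr 2
      funext e
      rw [List.map_map, Function.iterate_succ_apply', markov, ← sum_map_wordList,
        ← List.sum_map_mul_left]
      congr 2
      funext y
      simp only [Function.comp_apply]
      rw [← hmv, mul_assoc]
      simp only [← hcv (tab, e.2, y)]
  have h1 : Primrec fun s => (step (f s))^[t s] [((1, 0), x s)] :=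
    Primrec.nat_iterate ht
      (Primrec.list_cons.comp (Primrec.pair (Primrec.const (1, 0)) hx) (Primrec.const []))
      (hstep.comp (hf.comp fst) snd)
  refine (PrimrecReal.list_sum (g := fun s e => fracVal e.1 * h s e.2) h1
    ((PrimrecReal.fracVal_comp (fst.comp snd)).mul
      (hh.comp (Primrec.pair fst (snd.comp snd))))).of_eq fun s => ?_
  rw [hsum]
  simp [fracVal]

lemma primrecReal_occ :
    PrimrecReal fun p : ℕ × List A × List A => occ p.1 p.2.1 p.2.2 := by
  classical
  have h : PrimrecPred fun p : ℕ × List A × List A => p.2.1 <+: p.2.2.drop p.1 := by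
    refine PrimrecPred.of_eq (Primrec.eq.comp (fst.comp snd) (Primrec.list_take.comp
      (Primrec.list_length.comp (fst.comp snd)) (Primrec.list_drop.comp fst (snd.comp snd))))
      fun p => ?_
    exact List.prefix_iff_eq_take.symm
  refine (PrimrecReal.ite h (PrimrecReal.const_nat 1) (PrimrecReal.const_nat 0)).of_eq fun p => ?_
  unfold occ
  split_ifs <;> simp

lemma primrecReal_empirical (r : ℕ) (a : A) :
    PrimrecReal fun p : List ((List A × A) × ℕ × ℕ) × ℕ × List A × List A =>
      empirical r (tableRule r p.1) p.2.1 p.2.2.1 p.2.2.2 := by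
  have hT : PrimrecReal fun p : List ((List A × A) × ℕ × ℕ) × ℕ × List A × List A =>
      1 / ((p.2.1 : ℝ) + 1) := PrimrecReal.one_div_succ (fst.comp snd)
  refine ((hT.mul hT).mul (PrimrecReal.sum_range (Primrec.succ.comp (fst.comp snd))
    (g := fun p t => ∑ k ∈ Finset.range (p.2.1 + 1),
      (markov r (tableRule r p.1))^[t] (occ k p.2.2.2) p.2.2.1) ?_)).of_eq fun p => ?_
  · refine PrimrecReal.sum_range (Primrec.succ.comp (fst.comp (snd.comp fst))) ?_
    refine primrecReal_iterate_markov r a (fst.comp (fst.comp fst)) (snd.comp fst)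
      (fst.comp (snd.comp (snd.comp (fst.comp fst)))) ?_
    exact primrecReal_occ.comp (Primrec.pair (snd.comp fst)
      (Primrec.pair (snd.comp (snd.comp (snd.comp (fst.comp (fst.comp fst))))) snd))
  · rw [empirical, mul_inv, one_div]

lemma PrimrecReal.overlap {n : α → ℕ} {p q : α → List A → ℝ} (hn : Primrec n)
    (hp : PrimrecReal fun s : α × List A => p s.1 s.2)
    (hq : PrimrecReal fun s : α × List A => q s.1 s.2) :
    PrimrecReal fun a => overlap (n a) (p a) (q a) := by
  refine PrimrecReal.sum_range (Primrec.succ.comp hn) ((one_half_pow snd).mul ?_)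
  refine PrimrecReal.sum_wordSet (Primrec.succ.comp
    (Primrec.nat_mul.comp (Primrec.const 2) snd)) ?_
  exact (hp.comp (Primrec.pair (fst.comp fst) snd)).min (hq.comp (Primrec.pair (fst.comp fst) snd))

variable [MeasurableSpace A] [MeasurableSingletonClass A]

open Classical in
lemma onWords_periodicMeasure (w : A × List A) (v : List A) :
    (periodicMeasure w).onWords v = 1 / ((w.2.length : ℝ) + 1) *
      ∑ k ∈ Finset.range (w.2.length + 1),
        if v = (List.range v.length).map
          (fun i => (w.1 :: w.2).getD ((i + k) % (w.2.length + 1)) w.1) then 1 else 0 := by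
  have h1 : ∀ k, shift^[k] (periodicConf w) ∈ wordCyl 0 v ↔ v = (List.range v.length).map
      (fun i => (w.1 :: w.2).getD ((i + k) % (w.2.length + 1)) w.1) := by
    intro k
    rw [mem_wordCyl, List.ext_getElem_iff]
    simp only [List.length_map, List.length_range, true_and, List.getElem_map,
      List.getElem_range]
    have h2 : ∀ i : ℕ, (shift^[k] (periodicConf w)) (0 + i) =
        (w.1 :: w.2).getD ((i + k) % (w.2.length + 1)) w.1 := by
      intro i
      rw [shift_iterate_apply, periodicConf, zero_add]
      congr 1
    simp_rw [h2]
    exact ⟨fun h i hi _ => (h i hi).symm, fun h i hi => (h i hi hi).symm⟩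
  rw [InvMeasure.onWords, measureReal_def]
  simp only [periodicMeasure, Measure.smul_apply, Measure.finsetSum_apply, smul_eq_mul]
  rw [ENNReal.toReal_mul, ENNReal.toReal_sum fun k _ => measure_ne_top _ _]
  congr 1
  · rw [ENNReal.toReal_inv, ENNReal.toReal_natCast]
    simp
  · refine Finset.sum_congr rfl fun k _ => ?_
    rw [Measure.dirac_apply' _ (measurableSet_wordCyl 0 v), Set.indicator_apply]
    simp only [h1]
    split_ifs <;> simp

lemma primrecReal_periodicMeasure :
    PrimrecReal fun p : (A × List A) × List A => (periodicMeasure p.1).onWords p.2 := by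
  classical
  simp_rw [onWords_periodicMeasure]
  have hlen : Primrec fun p : (A × List A) × List A => p.1.2.length :=
    Primrec.list_length.comp (snd.comp fst)
  refine (PrimrecReal.one_div_succ hlen).mul (PrimrecReal.sum_range (Primrec.succ.comp hlen) ?_)
  have h : PrimrecPred fun p : ((A × List A) × List A) × ℕ =>
      p.1.2 = (List.range p.1.2.length).map
        (fun i => (p.1.1.1 :: p.1.1.2).getD ((i + p.2) % (p.1.1.2.length + 1)) p.1.1.1) := by
    refine Primrec.eq.comp (snd.comp fst) (Primrec.list_map
      (Primrec.list_range.comp (Primrec.list_length.comp (snd.comp fst))) ?_)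
    refine Primrec.option_getD.comp (Primrec.list_getElem?.comp (Primrec.list_cons.comp
      (fst.comp (fst.comp (fst.comp fst))) (snd.comp (fst.comp (fst.comp fst)))) ?_)
      (fst.comp (fst.comp (fst.comp fst)))
    exact Primrec.nat_mod.comp (Primrec.nat_add.comp snd (snd.comp fst))
      (Primrec.succ.comp (hlen.comp (fst.comp fst)))
  refine (PrimrecReal.ite h (PrimrecReal.const_nat 1) (PrimrecReal.const_nat 0)).of_eq fun p => ?_
  simp

end PrimrecWords

/-! ### Certificates -/

section Certificates

set_option linter.unusedSectionVars false

open Primrec Filter Topology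

lemma coe_unitRat (e : ℕ × ℕ) : (unitRat e : ℝ) = fracVal (min e.1 (e.2 + 1), e.2) := by
  simp [unitRat, fracVal]

lemma primrecReal_unitRat : PrimrecReal fun e : ℕ × ℕ => (unitRat e : ℝ) := by
  simp_rw [coe_unitRat]
  exact PrimrecReal.fracVal_comp
    (Primrec.pair (Primrec.nat_min.comp fst (Primrec.succ.comp snd)) snd)

lemma coe_ratOfCode (q : ℕ × ℕ × ℕ) :
    (ratOfCode q : ℝ) = fracVal (q.1, q.2.2) - fracVal (q.2.1, q.2.2) := by
  simp [ratOfCode, fracVal, sub_div]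

lemma denseRange_unitRat : DenseRange unitRat := by
  refine Metric.denseRange_iff.mpr fun x δ hδ => ?_
  obtain ⟨d, hd⟩ := exists_nat_one_div_lt hδ
  have hd0 : (0 : ℝ) < d + 1 := by positivity
  have h0 : (0 : ℝ) ≤ x * (d + 1) := mul_nonneg x.2.1 hd0.le
  have h1 : ⌊(x : ℝ) * (d + 1)⌋₊ ≤ d + 1 := by
    refine Nat.floor_le_of_le ?_
    push_cast
    nlinarith [x.2.2]
  refine ⟨(⌊(x : ℝ) * (d + 1)⌋₊, d), ?_⟩
  rw [Subtype.dist_eq, coe_unitRat, min_eq_left h1, Real.dist_eq, fracVal]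
  refine lt_of_le_of_lt ?_ hd
  have h2 := Nat.floor_le h0
  have h3 := (Nat.lt_floor_add_one ((x : ℝ) * (d + 1))).le
  have h4 : (x : ℝ) - (⌊(x : ℝ) * (d + 1)⌋₊ : ℝ) / (d + 1) =
      ((x : ℝ) * (d + 1) - ⌊(x : ℝ) * (d + 1)⌋₊) / (d + 1) := by field_simp
  rw [h4, abs_of_nonneg (div_nonneg (by linarith) hd0.le)]
  gcongr
  linarith

/-- The witness `(⌈j ρ⌉ - 1) / (j + 1)` is zero or strictly below `ρ`, because `⌈j ρ⌉ - 1 < j ρ`.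
The strict inequality leaves room for later errors; only a zero bound may lack it. Truncated
subtraction covers `⌈j ρ⌉ = 0`. -/
lemma exists_fracVal_lt (ρ : ℝ) (h0 : 0 ≤ ρ) (h1 : ρ ≤ 1) (j : ℕ) :
    ∃ c, |fracVal c - ρ| ≤ 2 * (1 / ((j : ℝ) + 1)) ∧ (fracVal c = 0 ∨ fracVal c < ρ) := by
  have hj : (0 : ℝ) < j + 1 := by positivity
  refine ⟨(⌈(j : ℝ) * ρ⌉₊ - 1, j), ?_⟩
  have h2 : ρ = ρ * (j + 1) / (j + 1) := by field_simp
  rcases Nat.eq_zero_or_pos ⌈(j : ℝ) * ρ⌉₊ with hc | hc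
  · have h3 : (j : ℝ) * ρ ≤ 0 := Nat.ceil_eq_zero.mp hc
    have h4 : fracVal (⌈(j : ℝ) * ρ⌉₊ - 1, j) = 0 := by simp [fracVal, hc]
    refine ⟨?_, Or.inl h4⟩
    rw [h4, zero_sub, abs_neg, abs_of_nonneg h0]
    calc ρ = ρ * (j + 1) / (j + 1) := h2
      _ ≤ 2 / (j + 1) := by gcongr; nlinarith
      _ = _ := by ring
  · have h3 := Nat.ceil_lt_add_one (mul_nonneg (Nat.cast_nonneg j) h0)
    have h4 := Nat.le_ceil ((j : ℝ) * ρ)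
    have h5 : fracVal (⌈(j : ℝ) * ρ⌉₊ - 1, j) = ((⌈(j : ℝ) * ρ⌉₊ : ℝ) - 1) / (j + 1) := by
      simp only [fracVal]
      rw [Nat.cast_sub hc, Nat.cast_one]
    have h6 : ((⌈(j : ℝ) * ρ⌉₊ : ℝ) - 1) / (j + 1) < ρ := by
      rw [div_lt_iff₀ hj]
      linarith
    refine ⟨?_, Or.inr (h5 ▸ h6)⟩
    rw [h5, abs_sub_comm, abs_of_pos (by linarith)]
    calc ρ - ((⌈(j : ℝ) * ρ⌉₊ : ℝ) - 1) / (j + 1)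
        = (ρ * (j + 1) - (⌈(j : ℝ) * ρ⌉₊ - 1)) / (j + 1) := by field_simp
      _ ≤ 2 / (j + 1) := by gcongr; linarith
      _ = _ := by ring

/-- The list is fixed, so `g i` need not be computable uniformly in `i`; this suits approximations
given separately for each matrix entry. -/
lemma computable_list_all {κ α : Type*} [Primcodable α] (L : List κ) (g : κ → α → Bool)
    (hg : ∀ i, Computable (g i)) : Computable fun a => L.all fun i => g i a := by
  induction L with
  | nil => exact Computable.const true
  | cons i L ih => exact Primrec.and.to_comp.comp (hg i) ih

lemma ComputableMap.continuous {X Y ι κ : Type*} [MetricSpace X] [MetricSpace Y] [Primcodable ι]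
    [Primcodable κ] {z : ι → X} {z' : κ → Y} {F : X → Y} (h : ComputableMap z z' F) :
    Continuous F := by
  obtain ⟨α, -, -, -, hα, -⟩ := h
  refine Metric.continuous_iff.mpr fun x ε hε => ?_
  obtain ⟨n, hn⟩ := exists_pow_lt_of_lt_one hε (by norm_num : (1 / 2 : ℝ) < 1)
  exact ⟨(1 / 2) ^ α n, by positivity, fun y hy => (hα n y x hy.le).trans_lt hn⟩

variable {A : Type*} [Fintype A]

/-- The pairs of a word of length at most `2 r + 1` and a letter. -/
def shortWords (A : Type*) [Fintype A] (r : ℕ) : Finset (List A × A) :=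
  open Classical in (Finset.range (2 * r + 2)).biUnion (wordSet A) ×ˢ Finset.univ

lemma mem_shortWords {r : ℕ} {e : List A × A} : e ∈ shortWords A r ↔ e.1.length ≤ 2 * r + 1 := by
  simp [shortWords, Nat.lt_succ_iff]

/-- A certificate: a noise parameter, a precision, a time and a table of lower bounds of the local
rule. -/
abbrev Certificate (A : Type*) := (ℕ × ℕ) × ℕ × ℕ × List ((List A × A) × ℕ × ℕ)

/-- The table of the certificate is below the local rule given by the approximations `β`. -/
def Certificate.IsBelow (r : ℕ) (β : List A × A → (ℕ × ℕ) × ℕ → ℕ × ℕ) (c : Certificate A)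
    (e : List A × A) : Prop :=
  tableRule r c.2.2.2 e.1 e.2 ≤ 0 ∨
    tableRule r c.2.2.2 e.1 e.2 + (1 / 2 : ℝ) ^ c.2.1 ≤ unitRat (β e (c.1, c.2.1))

variable [MeasurableSpace A] [MeasurableSingletonClass A]

/-- The noise parameter of the certificate is small, and all empirical averages for its table are
close to the periodic measure. -/
def Certificate.IsClose (r : ℕ) (s : (A × List A) × (ℕ × ℕ × ℕ) × ℕ) (c : Certificate A) : Prop :=
  0 < (unitRat c.1 : ℝ) ∧ (unitRat c.1 : ℝ) < 1 / ((s.2.2 : ℝ) + 1) ∧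
    ∀ x ∈ wordList A (blockLength r c.2.2.1), 2 + fracVal (s.2.1.2.1, s.2.1.2.2) <
      overlap c.2.2.1 (empirical r (tableRule r c.2.2.2) c.2.2.1 x)
        (periodicMeasure s.1).onWords + (fracVal (s.2.1.1, s.2.1.2.2) + 1 / ((s.2.2 : ℝ) + 1))

/-! ### Decidability of the conditions on a certificate -/

section Computability

variable [Primcodable A]

lemma primrecReal_overlap_empirical {α : Type*} [Primcodable α] (r : ℕ) (a : A)
    {tab : α → List ((List A × A) × ℕ × ℕ)} {T : α → ℕ} {x : α → List A} {w : α → A × List A}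
    (htab : Primrec tab) (hT : Primrec T) (hx : Primrec x) (hw : Primrec w) :
    PrimrecReal fun s => overlap (T s) (empirical r (tableRule r (tab s)) (T s) (x s))
      (periodicMeasure (w s)).onWords := by
  refine PrimrecReal.overlap (p := fun s => empirical r (tableRule r (tab s)) (T s) (x s))
    (q := fun s => (periodicMeasure (w s)).onWords) hT ?_ ?_
  · exact PrimrecReal.comp (f := fun s : α × List A => (tab s.1, T s.1, x s.1, s.2))
      (primrecReal_empirical r a) (Primrec.pair (htab.comp fst)
        (Primrec.pair (hT.comp fst) (Primrec.pair (hx.comp fst) snd)))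
  · exact PrimrecReal.comp (f := fun s : α × List A => (w s.1, s.2))
      primrecReal_periodicMeasure (Primrec.pair (hw.comp fst) snd)

lemma primrecRel_overlap_empirical {α : Type*} [Primcodable α] (r : ℕ) (a : A)
    {tab : α → List ((List A × A) × ℕ × ℕ)} {T : α → ℕ} {w : α → A × List A} {g h : α → ℝ}
    (htab : Primrec tab) (hT : Primrec T) (hw : Primrec w) (hg : PrimrecReal g)
    (hh : PrimrecReal h) :
    PrimrecPred fun s => ∀ x ∈ wordList A (blockLength r (T s)), g s <
      overlap (T s) (empirical r (tableRule r (tab s)) (T s) x) (periodicMeasure (w s)).onWords +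
        h s := by
  have hR : PrimrecRel fun (x : List A) (s : α) => g s <
      overlap (T s) (empirical r (tableRule r (tab s)) (T s) x) (periodicMeasure (w s)).onWords +
        h s :=
    (hg.comp snd).lt ((primrecReal_overlap_empirical r a (htab.comp snd) (hT.comp snd) fst
      (hw.comp snd)).add (hh.comp snd))
  exact hR.forall_mem_list.comp
    (primrec_wordList.comp (Primrec.nat_mul.comp (Primrec.const _) (Primrec.succ.comp hT)))
    Primrec.id

/-- The inequality in `Certificate.IsClose` has its negative terms moved across, as `PrimrecReal`
covers only non-negative values. -/
lemma primrecPred_isClose (r : ℕ) (a : A) :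
    PrimrecPred fun p : ((A × List A) × (ℕ × ℕ × ℕ) × ℕ) × Certificate A => p.2.IsClose r p.1 := by
  have hy : PrimrecReal fun p : ((A × List A) × (ℕ × ℕ × ℕ) × ℕ) × Certificate A =>
      1 / ((p.1.2.2 : ℝ) + 1) := PrimrecReal.one_div_succ (snd.comp (snd.comp fst))
  have he : PrimrecReal fun p : ((A × List A) × (ℕ × ℕ × ℕ) × ℕ) × Certificate A =>
      (unitRat p.2.1 : ℝ) := primrecReal_unitRat.comp (fst.comp snd)
  have h0 : PrimrecPred fun p : ((A × List A) × (ℕ × ℕ × ℕ) × ℕ) × Certificate A =>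
      0 < (unitRat p.2.1 : ℝ) :=
    ((PrimrecReal.const_nat 0).lt he).of_eq fun p => by rw [Nat.cast_zero]
  have hq : Primrec fun p : ((A × List A) × (ℕ × ℕ × ℕ) × ℕ) × Certificate A => p.1.2.1 :=
    fst.comp (snd.comp fst)
  have h1 : PrimrecReal fun p : ((A × List A) × (ℕ × ℕ × ℕ) × ℕ) × Certificate A =>
      2 + fracVal (p.1.2.1.2.1, p.1.2.1.2.2) :=
    ((PrimrecReal.const_nat 2).add (PrimrecReal.fracVal_comp (snd.comp hq))).of_eq fun p => by
      rw [Nat.cast_two]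
  have h2 : PrimrecReal fun p : ((A × List A) × (ℕ × ℕ × ℕ) × ℕ) × Certificate A =>
      fracVal (p.1.2.1.1, p.1.2.1.2.2) + 1 / ((p.1.2.2 : ℝ) + 1) :=
    (PrimrecReal.fracVal_comp (Primrec.pair (fst.comp hq) (snd.comp (snd.comp hq)))).add hy
  exact h0.and ((he.lt hy).and (primrecRel_overlap_empirical r a (snd.comp (snd.comp (snd.comp snd)))
    (fst.comp (snd.comp (snd.comp snd))) (fst.comp fst) h1 h2))

/-- Once the value of `β` is made a separate argument the test is primitive recursive; `β` itself is
only computable. -/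
lemma computable_isBelow (r : ℕ) (β : List A × A → (ℕ × ℕ) × ℕ → ℕ × ℕ)
    (hβ : ∀ e, Computable (β e)) (e : List A × A) :
    Computable fun c : Certificate A => open Classical in decide (c.IsBelow r β e) := by
  classical
  have h1 : PrimrecReal fun p : Certificate A × (ℕ × ℕ) => tableRule r p.1.2.2.2 e.1 e.2 :=
    (primrecReal_tableRule r).comp (Primrec.pair (snd.comp (snd.comp (snd.comp fst)))
      (Primrec.const e))
  have h2 : PrimrecPred fun p : Certificate A × (ℕ × ℕ) =>
      tableRule r p.1.2.2.2 e.1 e.2 ≤ 0 ∨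
        tableRule r p.1.2.2.2 e.1 e.2 + (1 / 2 : ℝ) ^ p.1.2.1 ≤ unitRat p.2 := by
    refine PrimrecPred.or ?_ ?_
    · exact (h1.le (PrimrecReal.const_nat 0)).of_eq fun p => by rw [Nat.cast_zero]
    · exact (h1.add (PrimrecReal.one_half_pow (fst.comp (snd.comp fst)))).le
        (primrecReal_unitRat.comp snd)
  refine (h2.decide.to_comp.comp (Computable.pair Computable.id ((hβ e).comp
    (Computable.pair Computable.fst (Computable.fst.comp Computable.snd))))).of_eq fun c => ?_
  exact decide_eq_decide.mpr Iff.rfl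

end Computability

/-! ### Soundness and existence of certificates -/

variable {N : Finset ℤ} {f : (N → A) → A} {φ : Set.Ioi (0 : ℝ) → StochRule A N}

/-- The functions `β` approximate the local rules at rational noise parameters. -/
def Approximates (r : ℕ) (a : A) (f : (N → A) → A) (φ : Set.Ioi (0 : ℝ) → StochRule A N)
    (β : List A × A → (ℕ × ℕ) × ℕ → ℕ × ℕ) : Prop :=
  ∀ e q n, dist (ruleEntry f φ (fun j => e.1.getD ((j : ℤ) + r).toNat a) e.2 (unitRat q))
    (unitRat (β e (q, n))) ≤ (1 / 2 : ℝ) ^ n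

lemma coe_ruleEntry (r : ℕ) (a : A) (z : List A) (b : A) (ε : unitInterval) (h : 0 < (ε : ℝ)) :
    (ruleEntry f φ (fun j => z.getD ((j : ℤ) + r).toNat a) b ε : ℝ) =
      wordRule r a (φ ⟨ε, h⟩) z b := by
  rw [ruleEntry, dif_pos h, wordRule]

lemma tableRule_take (r : ℕ) (tab : List ((List A × A) × ℕ × ℕ)) (z : List A) (b : A) :
    tableRule r tab (z.take (2 * r + 1)) b = tableRule r tab z b := by
  have h : (z.take (2 * r + 1)).take (2 * r + 1) = z.take (2 * r + 1) := by
    rw [List.take_take, min_self]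
  rw [tableRule, tableRule, h]

/-- A certificate confines all invariant measures at its noise parameter. -/
lemma Certificate.dist_le {r : ℕ} (hN : ∀ j ∈ N, j.natAbs ≤ r) {a : A}
    {β : List A × A → (ℕ × ℕ) × ℕ → ℕ × ℕ} (hβ : Approximates r a f φ β)
    {s : (A × List A) × (ℕ × ℕ × ℕ) × ℕ} {c : Certificate A} (hc : c.IsClose r s)
    (hb : ∀ e ∈ shortWords A r, c.IsBelow r β e) (μ : InvMeasure A)
    (hμ : μ ∈ invariantMeasures (φ ⟨unitRat c.1, hc.1⟩)) :
    dist μ (periodicMeasure s.1) ≤ ratOfCode s.2.1 + 1 / ((s.2.2 : ℝ) + 1) := by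
  have hloc := isLocalRule_wordRule r hN a (φ ⟨unitRat c.1, hc.1⟩)
  have hle : ∀ z b, tableRule r c.2.2.2 z b ≤ wordRule r a (φ ⟨unitRat c.1, hc.1⟩) z b := by
    intro z b
    -- Both rules read only the first `2 r + 1` letters, so the finitely many short words decide.
    rw [← tableRule_take, ← hloc.take]
    rcases hb (z.take (2 * r + 1), b) (mem_shortWords.mpr (by simp)) with h | h
    · exact h.trans (hloc.nonneg _ _)
    -- The margin `2⁻ⁿ` in the table absorbs the error of the approximation `β`.
    · have h2 := hβ (z.take (2 * r + 1), b) c.1 c.2.1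
      rw [Subtype.dist_eq, Real.dist_eq, coe_ruleEntry r a _ _ _ hc.1] at h2
      have := (abs_le.mp h2).1
      dsimp only at h this
      linarith
  have h := le_overlap_of_wordInvariant (tableRule_nonneg r c.2.2.2) hle μ.isWordMeasure_onWords
    ((mem_invariantMeasures_iff r hN a _ μ).mp hμ) c.2.2.1
    (2 + fracVal (s.2.1.2.1, s.2.1.2.2) - (fracVal (s.2.1.1, s.2.1.2.2) + 1 / ((s.2.2 : ℝ) + 1)))
    (q := (periodicMeasure s.1).onWords)
    fun x hx => by linarith [hc.2.2 x (mem_wordList.mpr hx)]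
  have h2 := dist_le_sub_overlap c.2.2.1 μ (periodicMeasure s.1)
  rw [coe_ratOfCode]
  linarith

lemma tableRule_map_toList (r : ℕ) (v : List A × A → ℕ × ℕ) (z : List A) (b : A) :
    tableRule r ((shortWords A r).toList.map fun e => (e, v e)) z b =
      fracVal (v (z.take (2 * r + 1), b)) := by
  classical
  rw [tableRule, List.map_map, Finset.sum_map_toList,
    Finset.sum_eq_single (z.take (2 * r + 1), b)]
  · simp
  · intro e _ he
    simp [he]
  · intro h
    exact absurd (mem_shortWords.mpr (by simp)) h

/-- If all invariant measures at some small noise parameter are close to a periodic measure, then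
there is a certificate for it. -/
lemma exists_certificate [Primcodable A] {r : ℕ} (hN : ∀ j ∈ N, j.natAbs ≤ r) {a : A}
    {β : List A × A → (ℕ × ℕ) × ℕ → ℕ × ℕ} (hβ : Approximates r a f φ β)
    (hcont : ∀ u b, Continuous (ruleEntry f φ u b))
    (s : (A × List A) × (ℕ × ℕ × ℕ) × ℕ) (ε : Set.Ioi (0 : ℝ))
    (hε : (ε : ℝ) < 1 / ((s.2.2 : ℝ) + 1))
    (h : ∀ μ ∈ invariantMeasures (φ ε),
      dist μ (periodicMeasure s.1) < ratOfCode s.2.1 + 1 / ((s.2.2 : ℝ) + 1)) :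
    ∃ c : Certificate A, c.IsClose r s ∧ ∀ e ∈ shortWords A r, c.IsBelow r β e := by
  have hloc := isLocalRule_wordRule r hN a (φ ε)
  set q := (periodicMeasure s.1).onWords with hq
  -- An overlap above `κ` corresponds to a distance below the admitted radius.
  set κ : ℝ := 2 - (ratOfCode s.2.1 + 1 / ((s.2.2 : ℝ) + 1)) with hκ
  obtain ⟨T, hT⟩ := hloc.exists_lt_overlap q
    (periodicMeasure s.1).isWordMeasure_onWords.nonneg κ (fun M hM hinv => by
      obtain ⟨μ, rfl⟩ := hM.exists_invMeasure
      by_contra! hc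
      refine absurd (h μ ((mem_invariantMeasures_iff r hN a _ μ).mpr hinv)) (not_lt.mpr ?_)
      exact le_dist_of_overlap_le fun n => by rw [← hq]; linarith [hc n])
  -- rational lower bounds of the rule
  have hle1 : ∀ z b, wordRule r a (φ ε) z b ≤ 1 := fun z b => ((φ ε).entry _ b).2.2
  choose v hv1 hv2 using fun (j : ℕ) (e : List A × A) =>
    exists_fracVal_lt (wordRule r a (φ ε) e.1 e.2) (hloc.nonneg _ _) (hle1 _ _) j
  let tab : ℕ → List ((List A × A) × ℕ × ℕ) :=
    fun j => (shortWords A r).toList.map fun e => (e, v j e)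
  have htab : Tendsto (fun j => tableRule r (tab j)) atTop (𝓝 (wordRule r a (φ ε))) := by
    refine tendsto_pi_nhds.mpr fun z => tendsto_pi_nhds.mpr fun b => ?_
    simp only [tab, tableRule_map_toList]
    rw [← hloc.take, tendsto_iff_dist_tendsto_zero]
    have h2 : Tendsto (fun j : ℕ => 2 * (1 / ((j : ℝ) + 1))) atTop (𝓝 0) := by
      simpa using tendsto_one_div_add_atTop_nhds_zero_nat.const_mul (2 : ℝ)
    exact squeeze_zero (fun _ => dist_nonneg) (fun j => hv1 j (z.take (2 * r + 1), b)) h2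
  -- Finitely many strict inequalities, continuous in the rule, persist for a table close enough to
  -- it.
  obtain ⟨j, hj⟩ : ∃ j, ∀ x ∈ wordSet A (blockLength r T),
      κ < overlap T (empirical r (tableRule r (tab j)) T x) q := by
    refine Eventually.exists (f := atTop) ((Filter.eventually_all_finset _).mpr fun x hx => ?_)
    have hc : Continuous fun ρ : List A → A → ℝ => overlap T (empirical r ρ T x) q :=
      (continuous_overlap T q).comp (continuous_pi fun v => continuous_empirical r T x v)
    exact ((hc.tendsto _).comp htab).eventually_const_lt (hT x (by simpa using hx))
  -- a precision
  obtain ⟨n, hn⟩ : ∃ n : ℕ, ∀ e ∈ shortWords A r, fracVal (v j e) = 0 ∨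
      fracVal (v j e) + 3 * (1 / 2 : ℝ) ^ n < wordRule r a (φ ε) e.1 e.2 := by
    refine Eventually.exists (f := atTop) ((Filter.eventually_all_finset _).mpr fun e _ => ?_)
    rcases hv2 j e with h0 | h0
    · exact Eventually.of_forall fun _ => Or.inl h0
    · have h3 : Tendsto (fun n : ℕ => fracVal (v j e) + 3 * (1 / 2 : ℝ) ^ n) atTop
          (𝓝 (fracVal (v j e) + 3 * 0)) :=
        ((tendsto_pow_atTop_nhds_zero_of_lt_one (by norm_num) (by norm_num)).const_mul 3).const_add _
      exact (h3.eventually_lt_const (by simpa using h0)).mono fun _ h => Or.inr h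
  -- a rational noise parameter
  have hε1 : (ε : ℝ) ≤ 1 := hε.le.trans (by
    rw [div_le_one (by positivity)]
    linarith [(Nat.cast_nonneg s.2.2 : (0 : ℝ) ≤ s.2.2)])
  let ε' : unitInterval := ⟨ε, ε.2.le, hε1⟩
  have hU : ∀ᶠ x : unitInterval in 𝓝 ε', 0 < (x : ℝ) ∧ (x : ℝ) < 1 / ((s.2.2 : ℝ) + 1) ∧
      ∀ e ∈ shortWords A r, dist (ruleEntry f φ (fun j => e.1.getD ((j : ℤ) + r).toNat a) e.2 x)
        (ruleEntry f φ (fun j => e.1.getD ((j : ℤ) + r).toNat a) e.2 ε') < (1 / 2 : ℝ) ^ n := by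
    refine ((continuous_subtype_val.tendsto ε').eventually_const_lt ε.2).and
      (((continuous_subtype_val.tendsto ε').eventually_lt_const hε).and
        ((Filter.eventually_all_finset _).mpr fun e _ => ?_))
    exact ((hcont _ e.2).tendsto ε').eventually (Metric.ball_mem_nhds _ (by positivity))
  obtain ⟨_, ⟨d, rfl⟩, h1, h2, h3⟩ :=
    ((mem_closure_iff_frequently.mp (denseRange_unitRat ε')).and_eventually hU).exists
  refine ⟨(d, n, T, tab j), ⟨h1, h2, fun x hx => ?_⟩, fun e he => ?_⟩
  · have h4 := hj x (by simpa using mem_wordList.mp hx)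
    rw [hκ, coe_ratOfCode] at h4
    dsimp only
    linarith
  · have h5 : tableRule r (tab j) e.1 e.2 = fracVal (v j e) := by
      simp only [tab, tableRule_map_toList]
      rw [List.take_of_length_le (mem_shortWords.mp he)]
    rcases hn e he with h6 | h6
    · exact Or.inl (h5.trans h6).le
    · right
      dsimp only
      rw [h5]
      have h7 := h3 e he
      have h8 := hβ e d n
      rw [Subtype.dist_eq, Real.dist_eq] at h7 h8
      have h9 : (ruleEntry f φ (fun j => e.1.getD ((j : ℤ) + r).toNat a) e.2 ε' : ℝ) =
          wordRule r a (φ ε) e.1 e.2 := coe_ruleEntry r a e.1 e.2 ε' ε.2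
      rw [h9] at h7
      -- The three terms `2⁻ⁿ` pay for the move from `ε` to the rational `d`, the error of `β` at
      -- `d`, and the margin required by `Certificate.IsBelow`.
      linarith [(abs_lt.mp h7).1, (abs_le.mp h8).2]

end Certificates

/-- A uniformly approached set of zero-noise limits of a computable perturbation is
`Π₂`-computable. -/
theorem isPi2Computable_zeroNoiseLimits {A : Type*} [Fintype A] [Primcodable A]
    [MeasurableSpace A] [MeasurableSingletonClass A] {N : Finset ℤ} {f : (N → A) → A}
    {φ : Set.Ioi (0 : ℝ) → StochRule A N} (hcomp : IsComputablePerturbation f φ)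
    (hunif : UniformlyApproached φ) :
    IsPi2Computable (periodicMeasure (A := A)) (zeroNoiseLimits φ) := by
  classical
  refine ⟨isClosed_acc _, ?_⟩
  rcases isEmpty_or_nonempty A with hA | hA
  -- An empty alphabet has no non-empty words, so nothing is to be decided.
  · exact ⟨fun _ => true, Computable.const true, fun i => isEmptyElim i.1⟩
  obtain ⟨a⟩ := id hA
  obtain ⟨r, hN⟩ := exists_natAbs_le N
  have hcont : ∀ u b, Continuous (ruleEntry f φ u b) := fun u b => (hcomp u b).continuous
  -- The modulus has served its purpose with continuity, which lets a real `ε` be replaced by a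
  -- rational one; only the approximations at rationals enter the algorithm.
  choose _ β _ hβ _ hβd using hcomp
  let β' : List A × A → (ℕ × ℕ) × ℕ → ℕ × ℕ :=
    fun e => β (fun j => e.1.getD ((j : ℤ) + r).toNat a) e.2
  have hβ' : Approximates r a f φ β' := fun e q n => hβd _ _ q n
  let g : ((A × List A) × (ℕ × ℕ × ℕ) × ℕ) × Certificate A → Bool := fun p =>
    decide (p.2.IsClose r p.1) && (shortWords A r).toList.all fun e => decide (p.2.IsBelow r β' e)
  have hg : Computable g :=
    Primrec.and.to_comp.comp (primrecPred_isClose r a).decide.to_comp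
      (computable_list_all _ _ fun e =>
        (computable_isBelow r β' (fun e => hβ _ _) e).comp Computable.snd)
  have hgt : ∀ s c, g (s, c) = true ↔ c.IsClose r s ∧ ∀ e ∈ shortWords A r, c.IsBelow r β' e := by
    intro s c
    simp [g]
  -- The variable `y₂` runs over codes of certificates. A number that codes none is read as a
  -- default certificate, which is harmless because it is put to the same test.
  have hdec : Primrec fun n : ℕ =>
      ((Encodable.decode n : Option (Certificate A)).getD ((0, 0), 0, 0, [])) :=
    Primrec.option_getD.comp Primrec.decode (Primrec.const _)
  refine ⟨fun p => g ((p.1, p.2.1, p.2.2.1),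
    (Encodable.decode p.2.2.2 : Option (Certificate A)).getD ((0, 0), 0, 0, [])),
    hg.comp (Primrec.to_comp ?_), fun w q => ⟨fun h y => ?_, fun h => ?_⟩⟩
  · exact Primrec.pair (Primrec.pair Primrec.fst (Primrec.pair (Primrec.fst.comp Primrec.snd)
      (Primrec.fst.comp (Primrec.snd.comp Primrec.snd))))
      (hdec.comp (Primrec.snd.comp (Primrec.snd.comp Primrec.snd)))
  · have hy : (0 : ℝ) < 1 / ((y : ℝ) + 1) := by positivity
    -- The bound on the noise and the slack in the radius are both `1 / (y + 1)`.
    obtain ⟨ε, hε, hd⟩ := exists_invariantMeasures_subset_ball hunif h hy hy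
    obtain ⟨c, hc⟩ := exists_certificate hN hβ' hcont (w, q, y) ε hε hd
    refine ⟨Encodable.encode c, ?_⟩
    dsimp only
    rw [Encodable.encodek, Option.getD_some]
    exact (hgt _ _).mpr hc
  · refine zeroNoiseLimits_inter_closedBall_nonempty fun y => ?_
    obtain ⟨n, hn⟩ := h y
    obtain ⟨hc, hb⟩ := (hgt _ _).mp hn
    exact ⟨_, hc.2.1, fun μ hμ => Certificate.dist_le hN hβ' hc hb μ hμ⟩

end NoisyCA

end

theorem mainTheorem6 {A : Type*} [Fintype A] [Primcodable A] [MeasurableSpace A]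
    [MeasurableSingletonClass A] (N : Finset ℤ) (f : (N → A) → A)
    (φ : Set.Ioi (0 : ℝ) → NoisyCA.StochRule A N)
    (hpert : NoisyCA.IsPerturbation f φ)
    (hcomp : NoisyCA.IsComputablePerturbation f φ)
    (hunif : NoisyCA.UniformlyApproached φ) :
    NoisyCA.IsPi2Computable (NoisyCA.periodicMeasure (A := A)) (NoisyCA.zeroNoiseLimits φ) :=
  NoisyCA.isPi2Computable_zeroNoiseLimits hcomp hunif
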